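/- Let $\mathbf{K}=\mathbf{R}$ or $\mathbf{C}$; manifolds, mappings and map-germs are of class $C^\infty$ if $\mathbf{K}=\mathbf{R}$ and complex analytic if $\mathbf{K}=\mathbf{C}$. Let $n\ge 1$, let $N$ be an $n$-dimensional manifold, $x_0\in N$, and let $(W,D)$ be a contact manifold of dimension $2n+1$ over $\mathbf{K}$, i.e. $D\subset TW$ is a completely non-integrable distribution of codimension one. Let $f:(N,x_0)\to W$ be an integral map-germ, i.e. $f_*(T_xN)\subset D_{f(x)}$ for all $x$ near $x_0$, and suppose that $f$ is of corank $\le 1$, i.e. the kernel of $f_*:T_{x_0}N\to T_{f(x_0)}W$ is of dimension at most one. Let $x_1,\dots,x_n$ be the standard coordinates of $\mathbf{K}^n$, and let $\mathbf{K}^{2n+1}$, with coordinates $(p,q,r)=(p_1,\dots,p_n,q_1,\dots,q_n,r)$, carry the contact structure $\{dr-\sum_{i=1}^n p_i\,dq_i=0\}$. Two map-germs $f:(N,x_0)\to (W,D)$ and $f':(N',x_0')\to (W',D')$ are called contactomorphic if there are a diffeomorphism-germ $\sigma:(N,x_0)\to(N',x_0')$ and a diffeomorphism-germ $\tau:(W,f(x_0))\to(W',f'(x_0'))$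 with $\tau_*D=D'$ such that $f'\circ\sigma=\tau\circ f$ (diffeomorphisms being biholomorphic if $\mathbf{K}=\mathbf{C}$). Then there exist function-germs $u,v:(\mathbf{K}^n,0)\to(\mathbf{K},0)$ such that the map-germ $f':(\mathbf{K}^n,0)\to(\mathbf{K}^{2n+1},0)$ defined by $$(q_1,\dots,q_{n-1},q_n,p_n)\circ f'=(x_1,\dots,x_{n-1},u,v),$$ $$p_i\circ f'=\int_0^{x_n}\left(\frac{\partial v}{\partial x_i}\frac{\partial u}{\partial x_n}-\frac{\partial v}{\partial x_n}\frac{\partial u}{\partial x_i}\right)dx_n\qquad(1\le i\le n-1),$$ $$r\circ f'=\int_0^{x_n} v\,\frac{\partial u}{\partial x_n}\,dx_n$$ is integral, and $f$ is contactomorphic to $f'$. -/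

import Mathlib

open Filter Topology
open scoped Manifold ContDiff

noncomputable section

namespace ContactGerm

/-! Throughout, `𝕜` is `ℝ` or `ℂ`. Differentiability is taken over `𝕜`, and the class of smoothness is
`∞`: for `𝕜 = ℝ` this is the `C^∞` category, and for `𝕜 = ℂ` it is the complex analytic category, since
a map between finite-dimensional complex spaces which is complex differentiable on an open set is
holomorphic there. A germ at a point is given by a representative, of which only the values near that
point matter. -/

section Contact

variable {𝕜 : Type*} [RCLike 𝕜]
  {F : Type*} [NormedAddCommGroup F] [NormedSpace 𝕜 F]

/-- The exterior derivative `dα (v, w)` at `x` of a `1`-form `α` on a vector space. -/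
def dForm (α : F → F →L[𝕜] 𝕜) (x v w : F) : 𝕜 :=
  fderiv 𝕜 α x v w - fderiv 𝕜 α x w v

/-- The `1`-form `α` is a contact form at the point `x`: it does not vanish there, and `dα` is
nondegenerate on the hyperplane `ker α`. In dimension `2 n + 1` this says that `α ∧ (dα)^n` is
nonzero at `x`. -/
def IsContactFormAt (α : F → F →L[𝕜] 𝕜) (x : F) : Prop :=
  α x ≠ 0 ∧ ∀ v, α x v = 0 → (∀ w, α x w = 0 → dForm α x v w = 0) → v = 0

variable {W : Type*} [TopologicalSpace W] [ChartedSpace F W]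

/-- The field of tangent subspaces `D` is a contact structure: near every point, read in a chart,
it is the field of kernels of a smooth contact form. (So it is a smooth field of hyperplanes which is
completely non-integrable.) -/
def IsContactStructure (D : ∀ w : W, Submodule 𝕜 (TangentSpace 𝓘(𝕜, F) w)) : Prop :=
  ∀ w₀ : W, ∃ α : F → F →L[𝕜] 𝕜,
    (∀ᶠ y in 𝓝 (extChartAt 𝓘(𝕜, F) w₀ w₀), ContDiffAt 𝕜 ∞ α y ∧ IsContactFormAt α y) ∧
    ∀ᶠ w in 𝓝 w₀, ∀ v : TangentSpace 𝓘(𝕜, F) w,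
      v ∈ D w ↔
        α (extChartAt 𝓘(𝕜, F) w₀ w)
          (mfderiv 𝓘(𝕜, F) 𝓘(𝕜, F) (extChartAt 𝓘(𝕜, F) w₀) w v) = 0

variable {E : Type*} [NormedAddCommGroup E] [NormedSpace 𝕜 E]
  {N : Type*} [TopologicalSpace N] [ChartedSpace E N]

/-- `f : (N, x₀) → (W, D)` is a smooth integral map-germ: near `x₀` it is smooth and its differential
takes its values in `D`. -/
def IsIntegralGerm (D : ∀ w : W, Submodule 𝕜 (TangentSpace 𝓘(𝕜, F) w)) (f : N → W) (x₀ : N) :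
    Prop :=
  ∀ᶠ x in 𝓝 x₀, ContMDiffAt 𝓘(𝕜, E) 𝓘(𝕜, F) ∞ f x ∧
    ∀ v : TangentSpace 𝓘(𝕜, E) x, mfderiv 𝓘(𝕜, E) 𝓘(𝕜, F) f x v ∈ D (f x)

variable (𝕜) in
/-- The corank of the map-germ `f` at `x₀`: the dimension of the kernel of its differential there. -/
def corank (f : N → W) (x₀ : N) : ℕ :=
  Module.finrank 𝕜 (LinearMap.ker (mfderiv 𝓘(𝕜, E) 𝓘(𝕜, F) f x₀).toLinearMap)

variable {F' : Type*} [NormedAddCommGroup F'] [NormedSpace 𝕜 F']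
  {W' : Type*} [TopologicalSpace W'] [ChartedSpace F' W']
  {E' : Type*} [NormedAddCommGroup E'] [NormedSpace 𝕜 E']
  {N' : Type*} [TopologicalSpace N'] [ChartedSpace E' N']

/-- The map-germs `f : (N, x₀) → (W, D)` and `f' : (N', x₀') → (W', D')` are contactomorphic: there are
a diffeomorphism-germ `σ : (N, x₀) → (N', x₀')` and a diffeomorphism-germ
`τ : (W, f x₀) → (W', f' x₀')` with `τ_* D = D'` such that `f' ∘ σ = τ ∘ f` as germs at `x₀`. -/
def Contactomorphic (D : ∀ w : W, Submodule 𝕜 (TangentSpace 𝓘(𝕜, F) w)) (f : N → W) (x₀ : N)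
    (D' : ∀ w : W', Submodule 𝕜 (TangentSpace 𝓘(𝕜, F') w)) (f' : N' → W') (x₀' : N') : Prop :=
  ∃ (σ : N → N') (τ : W → W'),
    IsLocalDiffeomorphAt 𝓘(𝕜, E) 𝓘(𝕜, E') ∞ σ x₀ ∧ σ x₀ = x₀' ∧
    IsLocalDiffeomorphAt 𝓘(𝕜, F) 𝓘(𝕜, F') ∞ τ (f x₀) ∧ τ (f x₀) = f' x₀' ∧
    (∀ᶠ w in 𝓝 (f x₀),
      (D w).map (mfderiv 𝓘(𝕜, F) 𝓘(𝕜, F') τ w).toLinearMap = D' (τ w)) ∧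
    f' ∘ σ =ᶠ[𝓝 x₀] τ ∘ f

end Contact

section Standard

variable (𝕜 : Type*) [RCLike 𝕜]

/-- The space `𝕜^{2n+1}` with coordinates `(p, q, r)`. -/
abbrev DarbouxSpace (n : ℕ) : Type _ := (Fin n → 𝕜) × (Fin n → 𝕜) × 𝕜

/-- The standard contact form `dr - ∑ᵢ pᵢ dqᵢ`. -/
def stdForm (n : ℕ) (w : DarbouxSpace 𝕜 n) : DarbouxSpace 𝕜 n →L[𝕜] 𝕜 :=
  let dq : DarbouxSpace 𝕜 n →L[𝕜] (Fin n → 𝕜) :=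
    (ContinuousLinearMap.fst 𝕜 (Fin n → 𝕜) 𝕜).comp
      (ContinuousLinearMap.snd 𝕜 (Fin n → 𝕜) ((Fin n → 𝕜) × 𝕜))
  let dr : DarbouxSpace 𝕜 n →L[𝕜] 𝕜 :=
    (ContinuousLinearMap.snd 𝕜 (Fin n → 𝕜) 𝕜).comp
      (ContinuousLinearMap.snd 𝕜 (Fin n → 𝕜) ((Fin n → 𝕜) × 𝕜))
  dr - ∑ i, w.1 i • (ContinuousLinearMap.proj (R := 𝕜) (φ := fun _ : Fin n => 𝕜) i).comp dq

theorem stdForm_apply (n : ℕ) (w v : DarbouxSpace 𝕜 n) :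
    stdForm 𝕜 n w v = v.2.2 - ∑ i, w.1 i * v.2.1 i := by
  simp [stdForm]

/-- The standard contact structure `{dr - ∑ᵢ pᵢ dqᵢ = 0}` on `𝕜^{2n+1}`. -/
def stdContact (n : ℕ) (w : DarbouxSpace 𝕜 n) :
    Submodule 𝕜 (TangentSpace 𝓘(𝕜, DarbouxSpace 𝕜 n) w) :=
  LinearMap.ker (stdForm 𝕜 n w).toLinearMap

variable {𝕜}

/-- The partial derivative `∂u/∂xᵢ`. -/
def partialDeriv {n : ℕ} (i : Fin n) (u : (Fin n → 𝕜) → 𝕜) (x : Fin n → 𝕜) : 𝕜 :=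
  fderiv 𝕜 u x (Pi.single i 1)

/-- The integral `∫₀^{xₙ} g(x₁, …, xₙ₋₁, s) ds` with respect to the last variable (`n = m + 1`), along
the straight segment `s = t xₙ`, `0 ≤ t ≤ 1`, in `𝕜`. -/
def lastIntegral {m : ℕ} (g : (Fin (m + 1) → 𝕜) → 𝕜) (x : Fin (m + 1) → 𝕜) : 𝕜 :=
  ∫ t in (0 : ℝ)..1, x (Fin.last m) * g (Function.update x (Fin.last m) (t * x (Fin.last m)))

/-- Over `ℝ` it is the usual integral. -/
theorem lastIntegral_real {m : ℕ} (g : (Fin (m + 1) → ℝ) → ℝ) (x : Fin (m + 1) → ℝ) :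
    lastIntegral g x = ∫ s in (0 : ℝ)..x (Fin.last m), g (Function.update x (Fin.last m) s) := by
  have h := intervalIntegral.smul_integral_comp_mul_right (a := (0 : ℝ)) (b := 1)
    (fun s => g (Function.update x (Fin.last m) s)) (x (Fin.last m))
  simpa [lastIntegral] using h

/-- The map `(𝕜ⁿ, 0) → 𝕜^{2n+1}` (`n = m + 1`) with
`(q₁, …, qₙ₋₁, qₙ, pₙ) = (x₁, …, xₙ₋₁, u, v)`,
`pᵢ = ∫₀^{xₙ} (∂v/∂xᵢ ∂u/∂xₙ - ∂v/∂xₙ ∂u/∂xᵢ) dxₙ` for `i < n`, and `r = ∫₀^{xₙ} v ∂u/∂xₙ dxₙ`. -/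
def preNormal {m : ℕ} (u v : (Fin (m + 1) → 𝕜) → 𝕜) (x : Fin (m + 1) → 𝕜) :
    DarbouxSpace 𝕜 (m + 1) :=
  (Fin.snoc (α := fun _ => 𝕜)
      (fun i : Fin m => lastIntegral (fun y =>
        partialDeriv i.castSucc v y * partialDeriv (Fin.last m) u y
          - partialDeriv (Fin.last m) v y * partialDeriv i.castSucc u y) x)
      (v x),
    Fin.snoc (α := fun _ => 𝕜) (fun i : Fin m => x i.castSucc) (u x),
    lastIntegral (fun y => v y * partialDeriv (Fin.last m) u y) x)

end Standard

end ContactGerm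

end

noncomputable section

namespace ContactGerm

/-! ### Inverse function theorem for smooth germs -/

section LocalInverse

variable {𝕜 : Type*} [RCLike 𝕜]
  {E : Type*} [NormedAddCommGroup E] [NormedSpace 𝕜 E]
  {F : Type*} [NormedAddCommGroup F] [NormedSpace 𝕜 F]

/-! Write n = m + 1. An integral map-germ has isotropic differential: differentiating α(df) = 0 and
antisymmetrizing gives dα(df v, df w) = 0 (`IsIntegralMapGerm.dForm_eq_zero`). As the corank is at
most one, the image of df at the base point contains m independent vectors of D on which dα
vanishes. Darboux coordinates (p, q, r) can be adapted to these vectors (`exists_darboux_germ`) so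
that the functions qᵢ ∘ f, i < n, have independent differentials. They become the coordinates xᵢ of
the source, completed by a linear form (`exists_source_coordinates`).

A contact transformation that subtracts functions of q₁, …, qₙ₋₁ from qₙ and r makes both vanish
along xₙ = 0 (`exists_contact_transformation`). With u = qₙ and v = pₙ, integrality now reads dr = ∑
pᵢ dxᵢ + v du. Its xₙ-component is ∂r/∂xₙ = v ∂u/∂xₙ; the others give pᵢ = ∂r/∂xᵢ - v ∂u/∂xᵢ, which
vanishes on xₙ = 0. In ∂pᵢ/∂xₙ the second derivatives cancel and the stated integrand remains, so
integration from xₙ = 0 recovers r and pᵢ (`eventuallyEq_preNormal`).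

The Darboux theorem comes from the Gray–Moser method (`exists_map_ker_linearization`). The segment
from α to its first-order expansion has a constant 1-jet at the base point, so the Moser vector
field vanishes there to second order and its flow reaches time one with identity differential. The
expansion itself is the pull-back of the standard form under a quadratic map
(`exists_pullback_eq_linearization`). To treat ℝ and ℂ together, the flow is obtained by applying
the inverse function theorem over 𝕜 to the integral equation, in the Banach space of continuous
curves on the real interval [0, 1] (`exists_flow`). -/

theorem eventually_isInvertible [CompleteSpace E] {X : Type*} [TopologicalSpace X]
    {g : X → E →L[𝕜] F} {a : X}
    (hg : ContinuousAt g a) (ha : (g a).IsInvertible) : ∀ᶠ x in 𝓝 a, (g x).IsInvertible := by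
  obtain ⟨e, he⟩ := ha
  have h := ContinuousLinearEquiv.nhds e
  rw [he] at h
  filter_upwards [hg.eventually_mem h] with x hx
  exact hx

/-- The inverse function theorem for smooth germs: both the map and the inverse are smooth on the
whole source and target. -/
theorem exists_openPartialHomeomorph [CompleteSpace E] {f : E → F} {a : E} {f' : E ≃L[𝕜] F}
    (hf : ∀ᶠ x in 𝓝 a, ContDiffAt 𝕜 ∞ f x) (hf' : HasFDerivAt f (f' : E →L[𝕜] F) a) :
    ∃ e : OpenPartialHomeomorph E F, (∀ x, e x = f x) ∧ a ∈ e.source ∧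
      (∀ x ∈ e.source, ContDiffAt 𝕜 ∞ f x) ∧ ∀ y ∈ e.target, ContDiffAt 𝕜 ∞ e.symm y := by
  have hfa : ContDiffAt 𝕜 ∞ f a := hf.self_of_nhds
  let e₀ := hfa.toOpenPartialHomeomorph f hf' (by simp)
  have he₀ : ∀ x, e₀ x = f x := fun x => rfl
  have hc : ContinuousAt (fderiv 𝕜 f) a :=
    (hfa.fderiv_right (m := 0) (by simp)).continuousAt
  have hinv : ∀ᶠ x in 𝓝 a, (fderiv 𝕜 f x).IsInvertible :=
    eventually_isInvertible hc (by rw [hf'.fderiv]; exact ⟨f', rfl⟩)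
  -- Restricting to an open set where the map is smooth with invertible derivative makes the inverse
  -- smooth on the whole target, not only at the image of `a`.
  obtain ⟨U, hU, hUo, haU⟩ := eventually_nhds_iff.1 (hf.and hinv)
  refine ⟨e₀.restrOpen U hUo, he₀, ?_, ?_, ?_⟩
  · exact ⟨hfa.mem_toOpenPartialHomeomorph_source hf' (by simp), haU⟩
  · intro x hx
    exact (hU x hx.2).1
  · intro y hy
    have hx := (e₀.restrOpen U hUo).map_target hy
    set x := (e₀.restrOpen U hUo).symm y
    obtain ⟨h1, g, hg⟩ := hU x hx.2
    refine (e₀.restrOpen U hUo).contDiffAt_symm (f₀' := g) hy ?_ h1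
    change HasFDerivAt f (g : E →L[𝕜] F) x
    rw [hg]
    exact (h1.differentiableAt (by simp)).hasFDerivAt

end LocalInverse

/-! ### Smoothness of the superposition operator on continuous maps -/

section Superposition

open Classical in
/-- The superposition operator `γ ↦ X ∘ γ` on continuous maps, with the value `0` where `X ∘ γ` is
not continuous. -/
def superpos (K : Type*) [TopologicalSpace K] {G H : Type*} [TopologicalSpace G]
    [TopologicalSpace H] [Zero H] (X : G → H) (γ : C(K, G)) : C(K, H) :=
  if h : Continuous (X ∘ γ) then ⟨X ∘ γ, h⟩ else 0

theorem superpos_apply {K : Type*} [TopologicalSpace K] {G H : Type*} [TopologicalSpace G]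
    [TopologicalSpace H] [Zero H] {X : G → H} {U : Set G} (hU : IsOpen U) (hX : ContinuousOn X U)
    {γ : C(K, G)} (hγ : ∀ t, γ t ∈ U) (t : K) : superpos K X γ t = X (γ t) := by
  have h : Continuous (X ∘ γ) := by
    rw [continuous_iff_continuousAt]
    intro t
    exact ContinuousAt.comp (hX.continuousAt (hU.mem_nhds (hγ t))) γ.continuous.continuousAt
  simp [superpos, h]

variable {𝕜 : Type*} [RCLike 𝕜] {K : Type*} [TopologicalSpace K] [CompactSpace K]

theorem isOpen_forall_mem {G : Type*} [TopologicalSpace G] {U : Set G} (hU : IsOpen U) :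
    IsOpen {γ : C(K, G) | ∀ t, γ t ∈ U} := by
  have := ContinuousMap.isOpen_setOfPred_mapsTo (X := K) (Y := G) isCompact_univ hU
  simpa [Set.MapsTo] using this

/-- The range of `γ` is compact, so a single `δ` serves for all `t`, both for the uniform continuity
of `X` and for staying inside `U`. -/
theorem exists_uniform_near {G H : Type*} [NormedAddCommGroup G] [NormedAddCommGroup H]
    {X : G → H} {U : Set G} (hU : IsOpen U) (hX : ContinuousOn X U)
    {γ : C(K, G)} (hγ : ∀ t, γ t ∈ U) {ε : ℝ} (hε : 0 < ε) :
    ∃ δ > 0, ∀ t, ∀ y, ‖y - γ t‖ < δ → y ∈ U ∧ ‖X y - X (γ t)‖ < ε := by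
  have hc : IsCompact (Set.range γ) := isCompact_range γ.continuous
  have h1 := hc.uniformContinuousAt_of_continuousAt X
    (by rintro _ ⟨t, rfl⟩; exact hX.continuousAt (hU.mem_nhds (hγ t)))
    (Metric.dist_mem_uniformity hε)
  obtain ⟨δ₁, hδ₁, h1⟩ := Metric.mem_uniformity_dist.1 h1
  obtain ⟨δ₂, hδ₂, h2⟩ := hc.exists_thickening_subset_open hU (by rintro _ ⟨t, rfl⟩; exact hγ t)
  refine ⟨min δ₁ δ₂, lt_min hδ₁ hδ₂, fun t y hy => ⟨?_, ?_⟩⟩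
  · refine h2 (Metric.mem_thickening_iff.2 ⟨γ t, ⟨t, rfl⟩, ?_⟩)
    rw [dist_eq_norm]; exact hy.trans_le (min_le_right _ _)
  · have := h1 (a := γ t) (b := y) (by
      rw [dist_comm, dist_eq_norm]; exact hy.trans_le (min_le_left _ _)) ⟨t, rfl⟩
    have h3 : dist (X (γ t)) (X y) < ε := this
    rwa [dist_comm, dist_eq_norm] at h3

theorem continuousOn_superpos {G H : Type*} [NormedAddCommGroup G] [NormedAddCommGroup H]
    {X : G → H} {U : Set G} (hU : IsOpen U) (hX : ContinuousOn X U) :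
    ContinuousOn (superpos K X) {γ | ∀ t, γ t ∈ U} := by
  intro γ hγ
  refine ContinuousAt.continuousWithinAt ?_
  rw [Metric.continuousAt_iff]
  intro ε hε
  obtain ⟨δ, hδ, h⟩ := exists_uniform_near hU hX hγ (half_pos hε)
  refine ⟨δ, hδ, fun {η} hη => ?_⟩
  have hη' : ∀ t, ‖η t - γ t‖ < δ := fun t => by
    rw [← dist_eq_norm]; exact (ContinuousMap.dist_apply_le_dist t).trans_lt hη
  have : dist (superpos K X η) (superpos K X γ) ≤ ε / 2 := by
    rw [ContinuousMap.dist_le (half_pos hε).le]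
    intro t
    rw [superpos_apply hU hX hγ, superpos_apply hU hX (fun t => (h t _ (hη' t)).1), dist_eq_norm]
    exact (h t _ (hη' t)).2.le
  linarith

variable {G H : Type*} [NormedAddCommGroup G] [NormedSpace 𝕜 G] [NormedAddCommGroup H]
  [NormedSpace 𝕜 H]

variable (𝕜 K G H) in
/-- Pointwise application of a continuous family of continuous linear maps. -/
def pointwiseApply : C(K, G →L[𝕜] H) →L[𝕜] C(K, G) →L[𝕜] C(K, H) :=
  LinearMap.mkContinuous₂
    (LinearMap.mk₂ 𝕜
      (fun (A : C(K, G →L[𝕜] H)) (γ : C(K, G)) => (⟨fun t => A t (γ t), by fun_prop⟩ : C(K, H)))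
      (fun A A' γ => by ext t; simp) (fun c A γ => by ext t; simp)
      (fun A γ γ' => by ext t; simp) (fun c A γ => by ext t; simp)) 1 (fun A γ => by
        rw [one_mul, ContinuousMap.norm_le _ (by positivity)]
        intro t
        exact ((A t).le_opNorm _).trans (mul_le_mul (A.norm_coe_le_norm t) (γ.norm_coe_le_norm t)
          (norm_nonneg _) (norm_nonneg A)))

@[simp] theorem pointwiseApply_apply (A : C(K, G →L[𝕜] H)) (γ : C(K, G)) (t : K) :
    pointwiseApply 𝕜 K G H A γ t = A t (γ t) := rfl

/-- The mean value inequality on the ball of radius `δ` about each `γ t` bounds the remainder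
pointwise by `ε ‖η t‖`. As `δ` does not depend on `t`, the bound holds in the sup norm. -/
theorem hasFDerivAt_superpos {X : G → H} {U : Set G} (hU : IsOpen U) (hX : ContDiffOn 𝕜 1 X U)
    {γ : C(K, G)} (hγ : ∀ t, γ t ∈ U) :
    HasFDerivAt (superpos K X) (pointwiseApply 𝕜 K G H (superpos K (fderiv 𝕜 X) γ)) γ := by
  let _ : NormedSpace ℝ G := NormedSpace.restrictScalars ℝ 𝕜 G
  have hX' : ContinuousOn (fderiv 𝕜 X) U := hX.continuousOn_fderiv_of_isOpen hU le_rfl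
  rw [hasFDerivAt_iff_isLittleO_nhds_zero, Asymptotics.isLittleO_iff]
  intro ε hε
  obtain ⟨δ, hδ, h⟩ := exists_uniform_near hU hX' hγ hε
  filter_upwards [Metric.ball_mem_nhds (0 : C(K, G)) hδ] with η hη
  rw [mem_ball_zero_iff] at hη
  have hη' : ∀ t, ‖η t‖ < δ := fun t => (η.norm_coe_le_norm t).trans_lt hη
  rw [ContinuousMap.norm_le _ (by positivity)]
  intro t
  have h1 : ∀ t, (γ + η) t ∈ U := fun t => (h t _ (by simpa using hη' t)).1
  simp only [ContinuousMap.sub_apply, pointwiseApply_apply]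
  rw [superpos_apply hU hX.continuousOn hγ, superpos_apply hU hX.continuousOn h1,
    superpos_apply hU hX' hγ]
  have h2 : ‖X (γ t + η t) - X (γ t) - fderiv 𝕜 X (γ t) (γ t + η t - γ t)‖ ≤
      ε * ‖γ t + η t - γ t‖ := by
    refine (convex_ball (γ t) δ).norm_image_sub_le_of_norm_hasFDerivWithin_le' (𝕜 := 𝕜)
      (f' := fderiv 𝕜 X) ?_ ?_ (Metric.mem_ball_self hδ) ?_
    · intro y hy
      have hyU := (h t y (by rwa [Metric.mem_ball, dist_eq_norm] at hy)).1
      exact ((hX.contDiffAt (hU.mem_nhds hyU)).differentiableAt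
        (by simp)).hasFDerivAt.hasFDerivWithinAt
    · intro y hy
      exact (h t y (by rwa [Metric.mem_ball, dist_eq_norm] at hy)).2.le
    · simpa using hη' t
  simp only [add_sub_cancel_left] at h2
  exact h2.trans (by gcongr; exact η.norm_coe_le_norm t)

end Superposition

section SuperpositionSmooth

universe u

variable {𝕜 : Type*} [RCLike 𝕜] {K : Type*} [TopologicalSpace K] [CompactSpace K]
  {G : Type u} [NormedAddCommGroup G] [NormedSpace 𝕜 G]

/-- The derivative is the superposition operator of `fderiv 𝕜 X` followed by the continuous linear
map `pointwiseApply`, whence the induction. The target `H` varies in it, and shares the universe of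
`G` so that `G →L[𝕜] H` is again an admissible target. -/
theorem contDiffOn_superpos_nat (n : ℕ) : ∀ {H : Type u} [NormedAddCommGroup H] [NormedSpace 𝕜 H]
    {X : G → H} {U : Set G}, IsOpen U → ContDiffOn 𝕜 n X U →
    ContDiffOn 𝕜 n (superpos K X) {γ | ∀ t, γ t ∈ U} := by
  induction n with
  | zero =>
    intro H _ _ X U hU hX
    exact contDiffOn_zero.2 (continuousOn_superpos hU (contDiffOn_zero.1 hX))
  | succ n ih =>
    intro H _ _ X U hU hX
    have hUo := isOpen_forall_mem (K := K) hU
    push_cast at hX ⊢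
    have hX1 : ContDiffOn 𝕜 1 X U := hX.of_le (by simp)
    have hX' := ((contDiffOn_succ_iff_fderiv_of_isOpen hU).1 hX).2.2
    have hd : ∀ γ ∈ {γ : C(K, G) | ∀ t, γ t ∈ U}, HasFDerivAt (superpos K X)
        (pointwiseApply 𝕜 K G H (superpos K (fderiv 𝕜 X) γ)) γ :=
      fun γ hγ => hasFDerivAt_superpos hU hX1 hγ
    rw [contDiffOn_succ_iff_fderiv_of_isOpen hUo]
    refine ⟨fun γ hγ => (hd γ hγ).differentiableAt.differentiableWithinAt, by simp, ?_⟩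
    refine ContDiffOn.congr ?_ (fun γ hγ => (hd γ hγ).fderiv)
    exact (pointwiseApply 𝕜 K G H).contDiff.comp_contDiffOn (ih hU hX')

/-- The superposition operator of a smooth map is smooth. -/
theorem contDiffOn_superpos {H : Type u} [NormedAddCommGroup H] [NormedSpace 𝕜 H]
    {X : G → H} {U : Set G} (hU : IsOpen U) (hX : ContDiffOn 𝕜 ∞ X U) :
    ContDiffOn 𝕜 ∞ (superpos K X) {γ | ∀ t, γ t ∈ U} :=
  contDiffOn_infty.2 fun n => contDiffOn_superpos_nat n hU (contDiffOn_infty.1 hX n)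

/-- The superposition operator of a smooth map is smooth: a version for two universes. -/
theorem contDiffOn_superpos_prod {P F : Type*} [NormedAddCommGroup P] [NormedSpace 𝕜 P]
    [NormedAddCommGroup F] [NormedSpace 𝕜 F] {X : P × F → F} {U : Set (P × F)} (hU : IsOpen U)
    (hX : ContDiffOn 𝕜 ∞ X U) : ContDiffOn 𝕜 ∞ (superpos K X) {γ | ∀ t, γ t ∈ U} := by
  -- Embedding `F` in `P × F` makes source and target the same space, hence of the same universe.
  have hX' : ContDiffOn 𝕜 ∞ (ContinuousLinearMap.inr 𝕜 P F ∘ X) U :=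
    (ContinuousLinearMap.inr 𝕜 P F).contDiff.comp_contDiffOn hX
  refine (((ContinuousLinearMap.snd 𝕜 P F).compLeftContinuous 𝕜 K).contDiff.comp_contDiffOn
    (contDiffOn_superpos hU hX')).congr fun γ hγ => ?_
  ext t
  rw [superpos_apply hU hX.continuousOn hγ]
  simp [superpos_apply hU hX'.continuousOn hγ]

end SuperpositionSmooth

/-! ### The integral equation of a curve -/

section Flow

open unitInterval

variable {𝕜 : Type*} [RCLike 𝕜] {F : Type*} [NormedAddCommGroup F] [NormedSpace 𝕜 F]
  [NormedSpace ℝ F] [IsScalarTower ℝ 𝕜 F]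

/-- The extension of a curve on `[0, 1]` to a curve on `ℝ`, constant outside `[0, 1]`. -/
def extendCurve {G : Type*} (γ : I → G) (t : ℝ) : G := γ (Set.projIcc 0 1 zero_le_one t)

theorem extendCurve_of_mem {G : Type*} (γ : I → G) {t : ℝ} (ht : t ∈ I) :
    extendCurve γ t = γ ⟨t, ht⟩ := by
  simp [extendCurve, Set.projIcc_of_mem zero_le_one ht]

theorem continuous_extendCurve {G : Type*} [TopologicalSpace G] (γ : C(I, G)) :
    Continuous (extendCurve γ) :=
  γ.continuous.comp continuous_projIcc

variable (𝕜 F) in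
/-- The operator of integration from `0`. -/
def integralOp : C(I, F) →L[𝕜] C(I, F) :=
  LinearMap.mkContinuous
    { toFun := fun γ => ⟨fun t => ∫ s in (0 : ℝ)..t, extendCurve γ s, by
        have := intervalIntegral.continuous_primitive (μ := MeasureTheory.volume)
          (fun a b => (continuous_extendCurve γ).intervalIntegrable a b) 0
        exact this.comp continuous_subtype_val⟩
      map_add' := fun γ η => by
        ext t
        exact intervalIntegral.integral_add ((continuous_extendCurve γ).intervalIntegrable _ _)
          ((continuous_extendCurve η).intervalIntegrable _ _)
      map_smul' := fun c γ => by
        ext t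
        exact intervalIntegral.integral_smul c _ } 1 (fun γ => by
      rw [one_mul, ContinuousMap.norm_le _ (norm_nonneg _)]
      intro t
      have h := intervalIntegral.norm_integral_le_of_norm_le_const (a := 0) (b := (t : ℝ))
        (f := extendCurve γ) (C := ‖γ‖) (fun s _ => γ.norm_coe_le_norm _)
      refine h.trans ?_
      rw [sub_zero, abs_of_nonneg t.2.1]
      exact mul_le_of_le_one_right (norm_nonneg _) t.2.2)

theorem integralOp_apply (γ : C(I, F)) (t : I) :
    integralOp 𝕜 F γ t = ∫ s in (0 : ℝ)..t, extendCurve γ s := rfl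

theorem extendCurve_zero_of_integral_eq {γ η : C(I, F)} {x : F}
    (h : ∀ t, γ t - integralOp 𝕜 F η t = x) : extendCurve γ 0 = x := by
  rw [extendCurve_of_mem _ ⟨le_rfl, zero_le_one⟩, ← h ⟨0, le_rfl, zero_le_one⟩, integralOp_apply]
  simp

/-- The fundamental theorem of calculus turns the integral equation into the differential equation.
The derivative is taken within `I`, because the extended curve is constant outside. -/
theorem hasDerivWithinAt_of_integral_eq [CompleteSpace F] {γ η : C(I, F)} {x : F}
    (h : ∀ t, γ t - integralOp 𝕜 F η t = x) {t : ℝ} (ht : t ∈ I) :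
    HasDerivWithinAt (extendCurve γ) (η ⟨t, ht⟩) I t := by
  have hc := continuous_extendCurve η
  have h1 : HasDerivAt (fun t => ∫ s in (0 : ℝ)..t, extendCurve η s) (extendCurve η t) t :=
    intervalIntegral.integral_hasDerivAt_right (hc.intervalIntegrable _ _)
      (hc.stronglyMeasurableAtFilter _ _) hc.continuousAt
  rw [extendCurve_of_mem _ ht] at h1
  refine (h1.const_add x).hasDerivWithinAt.congr (fun s hs => ?_) ?_
  · rw [extendCurve_of_mem _ hs, ← h ⟨s, hs⟩, integralOp_apply]; simp
  · rw [extendCurve_of_mem _ ht, ← h ⟨t, ht⟩, integralOp_apply]; simp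

end Flow
-- The time-one flow by the inverse function theorem
section FlowMap

open unitInterval

variable {𝕜 F : Type*} [RCLike 𝕜] [NormedAddCommGroup F] [NormedSpace 𝕜 F]

variable (𝕜 F) in
/-- The curve `t ↦ (t, 0)`. -/
def timeCurve : C(I, 𝕜 × F) := ⟨fun t => ((t : ℝ), 0), by
  exact (RCLike.continuous_ofReal.comp continuous_subtype_val).prodMk continuous_const⟩

variable (𝕜 F) in
/-- The map which sends a curve `γ` to the curve `t ↦ (0, γ t)`. -/
def inrCurve : C(I, F) →L[𝕜] C(I, 𝕜 × F) :=
  (ContinuousLinearMap.inr 𝕜 𝕜 F).compLeftContinuous 𝕜 I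

theorem graph_apply (γ : C(I, F)) (t : I) :
    (timeCurve 𝕜 F + inrCurve 𝕜 F γ) t = (((t : ℝ) : 𝕜), γ t) := by
  simp [timeCurve, inrCurve]

/-- The time-one map of a time-dependent vector field which vanishes to second order at the
origin, together with the solutions of the equation and of its linearisation. -/
theorem exists_flow [NormedSpace ℝ F] [IsScalarTower ℝ 𝕜 F] [CompleteSpace F]
    {X : 𝕜 × F → F} {U : Set (𝕜 × F)} (hU : IsOpen U) (hX : ContDiffOn 𝕜 ∞ X U)
    (h0 : ∀ t ∈ I, ((t : 𝕜), (0 : F)) ∈ U ∧ X ((t : 𝕜), 0) = 0 ∧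
      ∀ v, fderiv 𝕜 X ((t : 𝕜), 0) (0, v) = 0) :
    ∃ φ : F → F, (∀ᶠ x in 𝓝 0, ContDiffAt 𝕜 ∞ φ x) ∧ φ 0 = 0 ∧
      HasFDerivAt φ (ContinuousLinearMap.id 𝕜 F) 0 ∧
      ∀ᶠ x in 𝓝 0, ∀ v, ∃ c Y : ℝ → F, c 0 = x ∧ c 1 = φ x ∧ Y 0 = v ∧ Y 1 = fderiv 𝕜 φ x v ∧
        ∀ t ∈ I, ((t : 𝕜), c t) ∈ U ∧ HasDerivWithinAt c (X ((t : 𝕜), c t)) I t ∧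
          HasDerivWithinAt Y (fderiv 𝕜 X ((t : 𝕜), c t) (0, Y t)) I t := by
  set T : C(I, F) → C(I, 𝕜 × F) := fun γ => timeCurve 𝕜 F + inrCurve 𝕜 F γ with hT
  have hTapply : ∀ γ t, T γ t = (((t : ℝ) : 𝕜), γ t) := graph_apply
  have hTsmooth : ContDiff 𝕜 ∞ T := contDiff_const.add (inrCurve 𝕜 F).contDiff
  have hTd : ∀ γ, HasFDerivAt T (inrCurve 𝕜 F) γ := fun γ =>
    (inrCurve 𝕜 F).hasFDerivAt.const_add _
  set V : Set C(I, F) := T ⁻¹' {γ | ∀ t, γ t ∈ U} with hV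
  have hVo : IsOpen V := (isOpen_forall_mem hU).preimage hTsmooth.continuous
  -- A curve solves the equation with initial value `x` exactly when `Ψ γ` is the constant curve
  -- `x`, so the flow is an inverse of `Ψ` restricted to constant curves.
  set Ψ : C(I, F) → C(I, F) := fun γ => γ - integralOp 𝕜 F (superpos I X (T γ)) with hΨ
  have hΨsmooth : ContDiffOn 𝕜 ∞ Ψ V :=
    contDiffOn_id.sub ((integralOp 𝕜 F).contDiff.comp_contDiffOn
      ((contDiffOn_superpos_prod hU hX).comp hTsmooth.contDiffOn (fun _ h => h)))
  set P : C(I, F) → C(I, F) →L[𝕜] C(I, F) := fun γ =>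
    (pointwiseApply 𝕜 I (𝕜 × F) F (superpos I (fderiv 𝕜 X) (T γ))).comp (inrCurve 𝕜 F) with hP
  have hX' : ContinuousOn (fderiv 𝕜 X) U := hX.continuousOn_fderiv_of_isOpen hU (by simp)
  have hPapply : ∀ γ ∈ V, ∀ η t, P γ η t = fderiv 𝕜 X (((t : ℝ) : 𝕜), γ t) (0, η t) := by
    intro γ hγ η t
    simp only [hP, ContinuousLinearMap.comp_apply, pointwiseApply_apply]
    rw [superpos_apply hU hX' hγ, hTapply]
    simp [inrCurve]
  have hΨd : ∀ γ ∈ V, HasFDerivAt Ψ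
      (ContinuousLinearMap.id 𝕜 _ - (integralOp 𝕜 F).comp (P γ)) γ := fun γ hγ =>
    (hasFDerivAt_id γ).sub ((integralOp 𝕜 F).hasFDerivAt.comp γ
      ((hasFDerivAt_superpos hU (hX.of_le (by simp)) hγ).comp γ (hTd γ)))
  have h0V : (0 : C(I, F)) ∈ V := fun t => by rw [hTapply]; exact (h0 t t.2).1
  -- Here the vanishing of the spatial derivative of `X` at the origin enters: the derivative of `Ψ`
  -- at the zero curve is the identity, so solutions exist up to time one for all small initial
  -- values.
  have hP0 : P 0 = 0 := by
    ext η t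
    rw [hPapply 0 h0V]
    exact (h0 t t.2).2.2 _
  have hΨ0 : Ψ 0 = 0 := by
    have : superpos I X (T 0) = 0 := by
      ext t
      rw [superpos_apply hU hX.continuousOn h0V, hTapply]
      exact (h0 t t.2).2.1
    simp [hΨ, this]
  obtain ⟨e, he, h0e, -, hesymm⟩ := exists_openPartialHomeomorph (𝕜 := 𝕜) (f := Ψ) (a := 0)
    (f' := ContinuousLinearEquiv.refl 𝕜 _)
    (by filter_upwards [hVo.mem_nhds h0V] with γ hγ using hΨsmooth.contDiffAt (hVo.mem_nhds hγ))
    (by have := hΨd 0 h0V; rw [hP0] at this; simpa using this)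
  set cst : F →L[𝕜] C(I, F) := ContinuousLinearMap.const 𝕜 I
  have hcst : ∀ x t, cst x t = x := fun x t => rfl
  set Γ : F → C(I, F) := fun x => e.symm (cst x) with hΓ
  have h0t : (0 : C(I, F)) ∈ e.target := by
    have := e.map_source h0e
    rwa [he, hΨ0] at this
  have hΓ0 : Γ 0 = 0 := by
    have := e.left_inv h0e
    rw [he, hΨ0] at this
    simpa [hΓ] using this
  have htarget : ∀ᶠ x in 𝓝 (0 : F), cst x ∈ e.target :=
    cst.continuous.continuousAt.eventually_mem (by
      rw [map_zero]; exact e.open_target.mem_nhds h0t)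
  have hΓs : ∀ᶠ x in 𝓝 (0 : F), ContDiffAt 𝕜 ∞ Γ x := by
    filter_upwards [htarget] with x hx
    exact (hesymm _ hx).comp x cst.contDiff.contDiffAt
  have hΓV : ∀ᶠ x in 𝓝 (0 : F), Γ x ∈ V :=
    hΓs.self_of_nhds.continuousAt.eventually_mem (by rw [hΓ0]; exact hVo.mem_nhds h0V)
  have hΓeq : ∀ᶠ x in 𝓝 (0 : F), Ψ (Γ x) = cst x := by
    filter_upwards [htarget] with x hx
    rw [← he]; exact e.right_inv hx
  -- Differentiating `Ψ (Γ x) = cst x` gives the linearised equation in integral form.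
  have hΓd : ∀ᶠ x in 𝓝 (0 : F), ∀ v, fderiv 𝕜 Γ x v -
      integralOp 𝕜 F (P (Γ x) (fderiv 𝕜 Γ x v)) = cst v := by
    filter_upwards [hΓeq.eventually_nhds, hΓs, hΓV] with x h1 h2 h3 v
    have h4 := (hΨd _ h3).comp x (h2.differentiableAt (by simp)).hasFDerivAt
    have h5 : HasFDerivAt (Ψ ∘ Γ) cst x := cst.hasFDerivAt.congr_of_eventuallyEq h1
    have := DFunLike.congr_fun (h4.unique h5) v
    simpa using this
  have hone : (1 : ℝ) ∈ I := ⟨zero_le_one, le_rfl⟩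
  set ev : C(I, F) →L[𝕜] F := ContinuousMap.evalCLM 𝕜 (⟨1, hone⟩ : I)
  have hev : ∀ γ : C(I, F), ev γ = extendCurve γ 1 := fun γ => by
    rw [extendCurve_of_mem _ hone]; rfl
  have hφd : ∀ᶠ x in 𝓝 (0 : F), HasFDerivAt (fun x => ev (Γ x)) (ev.comp (fderiv 𝕜 Γ x)) x := by
    filter_upwards [hΓs] with x hx
    exact ev.hasFDerivAt.comp x (hx.differentiableAt (by simp)).hasFDerivAt
  refine ⟨fun x => ev (Γ x), ?_, by simp [hΓ0], ?_, ?_⟩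
  · filter_upwards [hΓs] with x hx
    exact ev.contDiff.contDiffAt.comp x hx
  · convert hφd.self_of_nhds using 1
    ext v
    have := hΓd.self_of_nhds v
    rw [hΓ0, hP0] at this
    simp only [_root_.zero_apply, map_zero, sub_zero] at this
    simp [this, hcst, ev]
  · filter_upwards [hΓs, hΓV, hΓeq, hΓd, hφd] with x h1 h2 h3 h4 h5 v
    have h3' : ∀ t, Γ x t - integralOp 𝕜 F (superpos I X (T (Γ x))) t = x := fun t => by
      rw [← ContinuousMap.sub_apply]; exact DFunLike.congr_fun h3 t
    have h4' : ∀ t, fderiv 𝕜 Γ x v t - integralOp 𝕜 F (P (Γ x) (fderiv 𝕜 Γ x v)) t = v :=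
      fun t => by
        rw [← ContinuousMap.sub_apply]; exact DFunLike.congr_fun (h4 v) t
    refine ⟨extendCurve (Γ x), extendCurve (fderiv 𝕜 Γ x v),
      extendCurve_zero_of_integral_eq h3', (hev _).symm, extendCurve_zero_of_integral_eq h4', ?_,
      fun t ht => ?_⟩
    · rw [h5.fderiv, ContinuousLinearMap.comp_apply, hev]
    · have hc := hasDerivWithinAt_of_integral_eq h3' ht
      have hY := hasDerivWithinAt_of_integral_eq h4' ht
      rw [superpos_apply hU hX.continuousOn h2, hTapply] at hc
      rw [hPapply _ h2] at hY
      rw [extendCurve_of_mem _ ht, extendCurve_of_mem _ ht]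
      refine ⟨?_, hc, hY⟩
      have := h2 ⟨t, ht⟩
      rwa [hTapply] at this

end FlowMap

/-! ### Transport of a one-form along the flow -/

section Pairing

variable {𝕜 : Type*} [RCLike 𝕜] {F : Type*} [NormedAddCommGroup F] [NormedSpace 𝕜 F]

/-- The derivative of `a (t, c t) (Y t)` along a solution `Y` of the linearised equation, when the
vector field `X` is annihilated by `a`. -/
theorem hasDerivWithinAt_pairing [NormedSpace ℝ F] [IsScalarTower ℝ 𝕜 F]
    {a : 𝕜 × F → F →L[𝕜] 𝕜} {A : 𝕜 × F →L[𝕜] F →L[𝕜] 𝕜} {X : 𝕜 × F → F} {c Y : ℝ → F} {S : Set ℝ}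
    {t : ℝ} (ha : HasFDerivAt a A ((t : 𝕜), c t)) (hX : DifferentiableAt 𝕜 X ((t : 𝕜), c t))
    (h0 : ∀ᶠ z in 𝓝 ((t : 𝕜), c t), a z (X z) = 0)
    (hc : HasDerivWithinAt c (X ((t : 𝕜), c t)) S t)
    (hY : HasDerivWithinAt Y (fderiv 𝕜 X ((t : 𝕜), c t) (0, Y t)) S t) :
    HasDerivWithinAt (fun s : ℝ => a ((s : 𝕜), c s) (Y s))
      (A (1, X ((t : 𝕜), c t)) (Y t) - A (0, Y t) (X ((t : 𝕜), c t))) S t := by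
  have h1 := (ha.comp ((((t : 𝕜), c t), Y t) : (𝕜 × F) × F)
    (ContinuousLinearMap.fst 𝕜 (𝕜 × F) F).hasFDerivAt).clm_apply
    (ContinuousLinearMap.snd 𝕜 (𝕜 × F) F).hasFDerivAt
  have h2 := ((((RCLike.ofRealCLM (K := 𝕜)).hasDerivAt (x := t)).hasDerivWithinAt
    (s := S)).prodMk hc).prodMk hY
  refine ((h1.restrictScalars ℝ).comp_hasDerivWithinAt t h2).congr_deriv ?_
  -- The identity `a z (X z) = 0`, differentiated in the direction `(0, Y t)`, trades the term
  -- containing the derivative of `X` for one containing only `A`.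
  have h4 : HasFDerivAt (fun z => a z (X z)) (0 : 𝕜 × F →L[𝕜] 𝕜) ((t : 𝕜), c t) :=
    (hasFDerivAt_const (0 : 𝕜) _).congr_of_eventuallyEq h0
  have h5 := DFunLike.congr_fun (h4.unique (ha.clm_apply hX.hasFDerivAt)) ((0 : 𝕜), Y t)
  change 0 = a ((t : 𝕜), c t) (fderiv 𝕜 X ((t : 𝕜), c t) (0, Y t)) +
    A (0, Y t) (X ((t : 𝕜), c t)) at h5
  change a ((t : 𝕜), c t) (fderiv 𝕜 X ((t : 𝕜), c t) (0, Y t)) +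
    A (((1 : ℝ) : 𝕜), X ((t : 𝕜), c t)) (Y t) = _
  rw [RCLike.ofReal_one]
  linear_combination -h5

end Pairing

/-! ### The linear system of a contact form -/

section Gray

set_option maxSynthPendingDepth 3

variable {𝕜 : Type*} [RCLike 𝕜] {F : Type*} [NormedAddCommGroup F] [NormedSpace 𝕜 F]
  [FiniteDimensional 𝕜 F]

theorem isInvertible_of_injective {F' : Type*} [NormedAddCommGroup F'] [NormedSpace 𝕜 F']
    [FiniteDimensional 𝕜 F'] (f : F →L[𝕜] F') (hf : Function.Injective f)
    (h : Module.finrank 𝕜 F = Module.finrank 𝕜 F') : f.IsInvertible :=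
  ⟨(f.toLinearMap.linearEquivOfInjective hf h).toContinuousLinearEquiv, by ext; rfl⟩

theorem finrank_dual : Module.finrank 𝕜 (F →L[𝕜] 𝕜) = Module.finrank 𝕜 F := by
  rw [← (LinearMap.toContinuousLinearMap (𝕜 := 𝕜) (E := F) (F' := 𝕜)).finrank_eq]
  exact Subspace.dual_finrank_eq

variable (𝕜 F) in
/-- The operator `(X, μ) ↦ (b(X, ·) - b(·, X) - μ a, a X)`, as a linear function of the bilinear
form `b` and of the linear form `a`. -/
def contactSystemₗ : ((F →L[𝕜] F →L[𝕜] 𝕜) × (F →L[𝕜] 𝕜)) →ₗ[𝕜]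
    ((F × 𝕜) →L[𝕜] ((F →L[𝕜] 𝕜) × 𝕜)) where
  toFun p := ((p.1 - p.1.flip).comp (ContinuousLinearMap.fst 𝕜 F 𝕜) -
    (ContinuousLinearMap.snd 𝕜 F 𝕜).smulRight p.2).prod
      (p.2.comp (ContinuousLinearMap.fst 𝕜 F 𝕜))
  map_add' p p' := by
    refine ContinuousLinearMap.ext fun z => Prod.ext (ContinuousLinearMap.ext fun w => ?_) rfl
    change (p.1 z.1 w + p'.1 z.1 w) - (p.1 w z.1 + p'.1 w z.1) - z.2 * (p.2 w + p'.2 w) =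
      (p.1 z.1 w - p.1 w z.1 - z.2 * p.2 w) + (p'.1 z.1 w - p'.1 w z.1 - z.2 * p'.2 w)
    ring
  map_smul' c p := by
    refine ContinuousLinearMap.ext fun z => Prod.ext (ContinuousLinearMap.ext fun w => ?_) rfl
    change c * p.1 z.1 w - c * p.1 w z.1 - z.2 * (c * p.2 w) =
      c * (p.1 z.1 w - p.1 w z.1 - z.2 * p.2 w)
    ring

variable (𝕜 F) in
/-- The continuous version of `contactSystemₗ`. -/
def contactSystem : ((F →L[𝕜] F →L[𝕜] 𝕜) × (F →L[𝕜] 𝕜)) →L[𝕜]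
    ((F × 𝕜) →L[𝕜] ((F →L[𝕜] 𝕜) × 𝕜)) :=
  LinearMap.toContinuousLinearMap (contactSystemₗ 𝕜 F)

theorem contactSystem_apply (b : F →L[𝕜] F →L[𝕜] 𝕜) (a : F →L[𝕜] 𝕜) (X : F) (μ : 𝕜) :
    contactSystem 𝕜 F (b, a) (X, μ) = (b X - b.flip X - μ • a, a X) := rfl

/-- The dimensions agree, so injectivity is enough. If dα(X, ·) = μ α and α(X) = 0, then X lies in
ker α and is dα-orthogonal to it, so X = 0 by nondegeneracy; then μ α = 0 forces μ = 0. -/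
theorem isInvertible_contactSystem {α : F → F →L[𝕜] 𝕜} {x : F} (h : IsContactFormAt α x) :
    (contactSystem 𝕜 F (fderiv 𝕜 α x, α x)).IsInvertible := by
  refine isInvertible_of_injective _ ?_ ?_
  · rw [injective_iff_map_eq_zero]
    rintro ⟨X, μ⟩ hX
    rw [contactSystem_apply, Prod.mk_eq_zero] at hX
    have hX0 : X = 0 := h.2 X hX.2 fun w hw => by
      have := DFunLike.congr_fun hX.1 w
      simpa [hw, dForm] using this
    subst hX0
    have : μ • α x = 0 := by simpa using hX.1
    simp [(smul_eq_zero.1 this).resolve_right h.1]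
  · rw [Module.finrank_prod, Module.finrank_prod, finrank_dual]

end Gray

/-! ### Gray's theorem by the Moser method -/

section Linearize

set_option maxSynthPendingDepth 3

open unitInterval

variable {𝕜 F : Type*} [RCLike 𝕜] [NormedAddCommGroup F] [NormedSpace 𝕜 F]
  [FiniteDimensional 𝕜 F]

set_option maxHeartbeats 800000 in
/-- Gray's theorem: the germ at the origin of the contact structure given by `α` is
equivalent to the one given by the first-order expansion of `α`, through a diffeomorphism-germ
which is tangent to the identity. -/
theorem exists_map_ker_linearization {α : F → F →L[𝕜] 𝕜}
    (hα : ∀ᶠ y in 𝓝 0, ContDiffAt 𝕜 ∞ α y) (hc : IsContactFormAt α 0) :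
    ∃ φ : F → F, (∀ᶠ x in 𝓝 0, ContDiffAt 𝕜 ∞ φ x) ∧ φ 0 = 0 ∧
      HasFDerivAt φ (ContinuousLinearMap.id 𝕜 F) 0 ∧
      ∀ᶠ x in 𝓝 0, ∀ v, α x v = 0 → (α 0 + fderiv 𝕜 α 0 (φ x)) (fderiv 𝕜 φ x v) = 0 := by
  let _ : NormedSpace ℝ F := NormedSpace.restrictScalars ℝ 𝕜 F
  have : IsScalarTower ℝ 𝕜 F := RestrictScalars.isScalarTower ℝ 𝕜 F
  have : CompleteSpace F := FiniteDimensional.complete 𝕜 F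
  obtain ⟨S, hS, hSo, h0S⟩ := eventually_nhds_iff.1 hα
  -- The segment `a (t, y) = α y + t β y` joins `α` to its first-order expansion; `w` is its
  -- derivative in `y`. Both `β` and its derivative vanish at the origin.
  set β : F → F →L[𝕜] 𝕜 := fun y => α 0 + fderiv 𝕜 α 0 y - α y with hβ
  set a : 𝕜 × F → F →L[𝕜] 𝕜 := fun z => α z.2 + z.1 • β z.2 with ha
  set w : 𝕜 × F → F →L[𝕜] F →L[𝕜] 𝕜 := fun z =>
    fderiv 𝕜 α z.2 + z.1 • (fderiv 𝕜 α 0 - fderiv 𝕜 α z.2) with hw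
  have hαS : ContDiffOn 𝕜 ∞ α S := fun y hy => (hS y hy).contDiffWithinAt
  have hα'S : ContDiffOn 𝕜 ∞ (fderiv 𝕜 α) S := hαS.fderiv_of_isOpen hSo (by simp)
  set V : Set (𝕜 × F) := Prod.snd ⁻¹' S with hV
  have hVo : IsOpen V := hSo.preimage continuous_snd
  have hαV : ContDiffOn 𝕜 ∞ (fun z : 𝕜 × F => α z.2) V :=
    hαS.comp contDiffOn_snd (fun _ h => h)
  have hα'V : ContDiffOn 𝕜 ∞ (fun z : 𝕜 × F => fderiv 𝕜 α z.2) V :=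
    hα'S.comp contDiffOn_snd (fun _ h => h)
  have hβV : ContDiffOn 𝕜 ∞ (fun z : 𝕜 × F => β z.2) V :=
    (contDiffOn_const.add ((fderiv 𝕜 α 0).contDiff.comp_contDiffOn contDiffOn_snd)).sub hαV
  have haV : ContDiffOn 𝕜 ∞ a V := hαV.add (contDiffOn_fst.smul hβV)
  have hwV : ContDiffOn 𝕜 ∞ w V := hα'V.add (contDiffOn_fst.smul (contDiffOn_const.sub hα'V))
  have hβd : ∀ y ∈ S, HasFDerivAt β (fderiv 𝕜 α 0 - fderiv 𝕜 α y) y := fun y hy =>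
    ((fderiv 𝕜 α 0).hasFDerivAt.const_add _).sub
      ((hS y hy).differentiableAt (by simp)).hasFDerivAt
  have had : ∀ z ∈ V, HasFDerivAt a ((w z).comp (ContinuousLinearMap.snd 𝕜 𝕜 F) +
      (ContinuousLinearMap.fst 𝕜 𝕜 F).smulRight (β z.2)) z := by
    intro z hz
    have h1 := ((hS z.2 hz).differentiableAt (by simp)).hasFDerivAt.comp z
      (ContinuousLinearMap.snd 𝕜 𝕜 F).hasFDerivAt
    have h2 := (hβd z.2 hz).comp z (ContinuousLinearMap.snd 𝕜 𝕜 F).hasFDerivAt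
    refine (h1.add ((ContinuousLinearMap.fst 𝕜 𝕜 F).hasFDerivAt.smul h2)).congr_fderiv ?_
    ext <;> simp [hw]
  set A : 𝕜 × F → (F × 𝕜) →L[𝕜] ((F →L[𝕜] 𝕜) × 𝕜) := fun z => contactSystem 𝕜 F (w z, a z) with hA
  have hAV : ContDiffOn 𝕜 ∞ A V := (contactSystem 𝕜 F).contDiff.comp_contDiffOn (hwV.prodMk haV)
  set U : Set (𝕜 × F) := {z | z ∈ V ∧ (A z).IsInvertible} with hU
  have hUo : IsOpen U := by
    rw [isOpen_iff_mem_nhds]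
    rintro z ⟨hz, hz'⟩
    filter_upwards [hVo.mem_nhds hz,
      eventually_isInvertible (hAV.continuousOn.continuousAt (hVo.mem_nhds hz)) hz'] with y h1 h2
    exact ⟨h1, h2⟩
  -- Moser's equation: with aₜ(X) = 0 and daₜ(X, ·) + β = μ aₜ, the form aₜ is only rescaled along
  -- the flow of X, so its kernel is carried along.
  set b : 𝕜 × F → (F →L[𝕜] 𝕜) × 𝕜 := fun z => (-β z.2, 0) with hb
  have hbV : ContDiffOn 𝕜 ∞ b V := hβV.neg.prodMk contDiffOn_const
  have hinvU : ContDiffOn 𝕜 ∞ (fun z => (A z).inverse) U := fun z hz =>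
    (hz.2.contDiffAt_map_inverse.comp z (hAV.contDiffAt (hVo.mem_nhds hz.1))).contDiffWithinAt
  set sol : 𝕜 × F → F × 𝕜 := fun z => (A z).inverse (b z) with hsol
  have hsolU : ContDiffOn 𝕜 ∞ sol U := hinvU.clm_apply (hbV.mono fun z hz => hz.1)
  set X : 𝕜 × F → F := fun z => (sol z).1 with hX
  set μ : 𝕜 × F → 𝕜 := fun z => (sol z).2 with hμ
  have hXU : ContDiffOn 𝕜 ∞ X U := contDiff_fst.comp_contDiffOn hsolU
  have hμU : ContinuousOn μ U := continuous_snd.comp_continuousOn hsolU.continuousOn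
  have hsys : ∀ z ∈ U, w z (X z) - (w z).flip (X z) - μ z • a z = -β z.2 ∧ a z (X z) = 0 := by
    intro z hz
    have h1 : A z (X z, μ z) = b z := hz.2.self_apply_inverse (b z)
    rw [hA] at h1
    simp only [contactSystem_apply, hb, Prod.mk.injEq] at h1
    exact h1
  have hβ0 : β 0 = 0 := by simp [hβ]
  have h0U : ∀ s : 𝕜, (s, (0 : F)) ∈ U := by
    intro s
    refine ⟨h0S, ?_⟩
    have h1 : w (s, 0) = fderiv 𝕜 α 0 := by simp [hw]
    have h2 : a (s, 0) = α 0 := by simp [ha, hβ0]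
    simp only [hA, h1, h2]
    exact isInvertible_contactSystem hc
  have hb0 : ∀ s : 𝕜, b (s, 0) = 0 := fun s => by simp [hb, hβ0]
  -- The right-hand side `b` vanishes to second order along `y = 0`, hence so does the solution.
  have hsold : ∀ s : 𝕜, HasFDerivAt sol (0 : 𝕜 × F →L[𝕜] F × 𝕜) (s, 0) := by
    intro s
    have h1 := ((hinvU.contDiffAt (hUo.mem_nhds (h0U s))).differentiableAt (by simp)).hasFDerivAt
    have h2 : HasFDerivAt b (0 : 𝕜 × F →L[𝕜] (F →L[𝕜] 𝕜) × 𝕜) (s, (0 : F)) := by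
      have h3 := (hβd 0 h0S).comp (s, (0 : F)) (ContinuousLinearMap.snd 𝕜 𝕜 F).hasFDerivAt
      rw [sub_self, ContinuousLinearMap.zero_comp] at h3
      simpa using! h3.neg.prodMk (hasFDerivAt_const (0 : 𝕜) (s, (0 : F)))
    refine (h1.clm_apply h2).congr_fderiv ?_
    rw [hb0]
    simp
  have hXd : ∀ s : 𝕜, HasFDerivAt X (0 : 𝕜 × F →L[𝕜] F) (s, 0) := fun s => by
    simpa using! (hsold s).fst
  obtain ⟨φ, hφ, hφ0, hφd, hflow⟩ := exists_flow hUo hXU (fun t _ =>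
    ⟨h0U t, by simp [hX, hsol, hb0], fun v => by rw [(hXd t).fderiv]; rfl⟩)
  refine ⟨φ, hφ, hφ0, hφd, ?_⟩
  filter_upwards [hflow] with x hx v hv
  obtain ⟨c, Y, hc0, hc1, hY0, hY1, hcY⟩ := hx v
  set g : ℝ → 𝕜 := fun t => a ((t : 𝕜), c t) (Y t) with hg
  have hgd : ∀ t ∈ I, HasDerivWithinAt g (μ ((t : 𝕜), c t) * g t) I t := by
    intro t ht
    obtain ⟨hU', hct, hYt⟩ := hcY t ht
    refine (hasDerivWithinAt_pairing (had _ hU'.1)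
      ((hXU.contDiffAt (hUo.mem_nhds hU')).differentiableAt (by simp))
      (by filter_upwards [hUo.mem_nhds hU'] with z hz using (hsys z hz).2) hct hYt).congr_deriv ?_
    have h6 := DFunLike.congr_fun (hsys _ hU').1 (Y t)
    change _ = μ _ * a ((t : 𝕜), c t) (Y t)
    generalize ((t : 𝕜), c t) = z at *
    change w z (X z) (Y t) - w z (Y t) (X z) - μ z * a z (Y t) = -β z.2 (Y t) at h6
    change w z (X z) (Y t) + 1 * β z.2 (Y t) - (w z (Y t) (X z) + 0 * β z.2 (X z)) =
      μ z * a z (Y t)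
    linear_combination h6
  have hgc : ContinuousOn g I := fun t ht => (hgd t ht).continuousWithinAt
  have hcc : ContinuousOn (fun t : ℝ => μ ((t : 𝕜), c t)) I :=
    hμU.comp (RCLike.continuous_ofReal.continuousOn.prodMk
      fun t ht => (hcY t ht).2.1.continuousWithinAt) fun t ht => (hcY t ht).1
  obtain ⟨K, hK⟩ := isCompact_Icc.exists_bound_of_continuousOn hcc
  -- The function `g` solves `g' = μ g` with `g 0 = α x v = 0`, so Grönwall's inequality makes it
  -- vanish. At time one the form is the first-order expansion.
  have hg1 : g 1 = 0 := by
    refine eq_zero_of_abs_deriv_le_mul_abs_self_of_eq_zero_right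
      (f' := fun t => μ ((t : 𝕜), c t) * g t) (K := K) hgc
      (fun t ht => ?_) ?_ (fun t ht => ?_) 1 ⟨zero_le_one, le_rfl⟩
    · exact (hgd t ⟨ht.1, ht.2.le⟩).mono_of_mem_nhdsWithin (Icc_mem_nhdsGE_of_mem ht)
    · simp [hg, ha, hc0, hY0, hv]
    · rw [norm_mul]
      gcongr
      exact hK t ⟨ht.1, ht.2.le⟩
  rw [← hc1, ← hY1]
  simpa [hg, ha, hβ] using hg1

end Linearize

/-! ### Linear Darboux coordinates -/

section SymplecticBasis

variable {𝕜 : Type*} [RCLike 𝕜] {F : Type*} [NormedAddCommGroup F] [NormedSpace 𝕜 F]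
  [FiniteDimensional 𝕜 F]

/-- An isotropic family of `m` vectors of `ker a` can be extended to an isotropic family of `m + 1`
vectors, if the dimension allows it. -/
theorem exists_isotropic_extension {m : ℕ} (hF : Module.finrank 𝕜 F = 2 * (m + 1) + 1)
    (a : F →L[𝕜] 𝕜) (b : F →L[𝕜] F →L[𝕜] 𝕜) (hb : ∀ v w, b v w = -b w v) {e : Fin m → F}
    (he : LinearIndependent 𝕜 e) (ha : ∀ i, a (e i) = 0) (hbe : ∀ i j, b (e i) (e j) = 0) :
    ∃ x, LinearIndependent 𝕜 (Fin.snoc e x : Fin (m + 1) → F) ∧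
      (∀ i, a ((Fin.snoc e x : Fin (m + 1) → F) i) = 0) ∧
      ∀ i j, b ((Fin.snoc e x : Fin (m + 1) → F) i) ((Fin.snoc e x : Fin (m + 1) → F) j) = 0 := by
  set l : F →ₗ[𝕜] 𝕜 × (Fin m → 𝕜) :=
    a.toLinearMap.prod (LinearMap.pi fun i => (b (e i)).toLinearMap) with hl
  have h1 := l.finrank_range_add_finrank_ker
  have h2 : Module.finrank 𝕜 (LinearMap.range l) ≤ 1 + m := by
    simpa using (LinearMap.range l).finrank_le
  have h3 : Module.finrank 𝕜 (Submodule.span 𝕜 (Set.range e)) = m := by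
    simpa using finrank_span_eq_card he
  -- The `1 + m` linear conditions leave a kernel of dimension at least `m + 2`, larger than the
  -- span of the `m` given vectors.
  have h4 : ¬ LinearMap.ker l ≤ Submodule.span 𝕜 (Set.range e) := fun h => by
    have := Submodule.finrank_mono h
    omega
  obtain ⟨x, hx, hxe⟩ := SetLike.not_le_iff_exists.1 h4
  rw [LinearMap.mem_ker] at hx
  have hxa : a x = 0 := congrArg Prod.fst hx
  have hxb : ∀ i, b (e i) x = 0 := fun i => congrFun (congrArg Prod.snd hx) i
  have hxx : b x x = 0 := by
    have := hb x x
    rwa [eq_neg_iff_add_eq_zero, ← two_mul, mul_eq_zero, or_iff_right two_ne_zero] at this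
  refine ⟨x, linearIndependent_finSnoc.2 ⟨he, hxe⟩, fun i => ?_, fun i j => ?_⟩
  · refine Fin.lastCases ?_ (fun i => ?_) i <;> simp [hxa, ha]
  · refine Fin.lastCases ?_ (fun i => ?_) i <;> refine Fin.lastCases ?_ (fun j => ?_) j
    · simpa using hxx
    · rw [hb]; simp [hxb]
    · simp [hxb]
    · simp [hbe]

/-- Linear Darboux coordinates adapted to an isotropic family of vectors. -/
theorem exists_darboux_equiv {m : ℕ} (hF : Module.finrank 𝕜 F = 2 * (m + 1) + 1)
    {α : F → F →L[𝕜] 𝕜} {x₀ : F} (hc : IsContactFormAt α x₀) {e : Fin m → F}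
    (he : LinearIndependent 𝕜 e) (ha : ∀ i, α x₀ (e i) = 0)
    (hbe : ∀ i j, dForm α x₀ (e i) (e j) = 0) :
    ∃ T : F ≃L[𝕜] DarbouxSpace 𝕜 (m + 1), (∀ v, (T v).2.2 = α x₀ v) ∧
      (∀ v w, dForm α x₀ v w =
        ∑ i, ((T v).2.1 i * (T w).1 i - (T v).1 i * (T w).2.1 i)) ∧
      ∀ i j, (T (e i)).2.1 j = (Pi.single i.castSucc 1 : Fin (m + 1) → 𝕜) j := by
  set a := α x₀
  set b : F →L[𝕜] F →L[𝕜] 𝕜 := fderiv 𝕜 α x₀ - (fderiv 𝕜 α x₀).flip with hbdef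
  have hdb : ∀ v w, dForm α x₀ v w = b v w := fun v w => rfl
  have hskew : ∀ v w, b v w = -b w v := fun v w => by
    rw [← hdb, ← hdb, dForm, dForm, neg_sub]
  simp only [hdb] at hbe ⊢
  obtain ⟨x, hli, hae, hbe'⟩ := exists_isotropic_extension hF a b hskew he ha hbe
  set ε : Fin (m + 1) → F := Fin.snoc e x with hε
  have hsolve : ∀ (ξ : F →L[𝕜] 𝕜) (s : 𝕜), ∃ f μ, a f = s ∧ ∀ w, b f w = ξ w + μ * a w := by
    intro ξ s
    have h1 := (isInvertible_contactSystem hc).self_apply_inverse (ξ, s)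
    set p := (contactSystem 𝕜 F (fderiv 𝕜 α x₀, α x₀)).inverse (ξ, s)
    rw [show p = (p.1, p.2) from rfl, contactSystem_apply, Prod.mk.injEq] at h1
    refine ⟨p.1, p.2, h1.2, fun w => ?_⟩
    have h2 : b p.1 w - p.2 * a w = ξ w := DFunLike.congr_fun h1.1 w
    linear_combination h2
  -- This is the Reeb vector: evaluating at `R` itself shows that `μ = 0`.
  obtain ⟨R, μ, hRa, hRμ⟩ := hsolve 0 1
  have hR : ∀ w, b R w = 0 := by
    have h1 : b R R = 0 := by
      have := hskew R R
      rwa [eq_neg_iff_add_eq_zero, ← two_mul, mul_eq_zero, or_iff_right two_ne_zero] at this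
    have h2 := hRμ R
    rw [hRa, h1] at h2
    have h3 : μ = 0 := by simpa using h2.symm
    intro w
    simpa [h3] using hRμ w
  obtain ⟨g, hg⟩ := (Fintype.linearCombination 𝕜 ε).exists_leftInverse_of_injective
    (LinearMap.ker_eq_bot.2 (linearIndependent_iff_injective_fintypeLinearCombination.1 hli))
  have hgε : ∀ i, g (ε i) = Pi.single i 1 := fun i => by
    have := LinearMap.congr_fun hg (Pi.single i 1)
    simpa [Fintype.linearCombination_apply_single] using this
  have hf₀ : ∀ j, ∃ f, a f = 0 ∧ ∀ i, b (ε i) f = if i = j then 1 else 0 := by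
    intro j
    obtain ⟨f, ν, hf, hfν⟩ := hsolve
      (-((LinearMap.proj j : (Fin (m + 1) → 𝕜) →ₗ[𝕜] 𝕜).comp g).toContinuousLinearMap) 0
    refine ⟨f, hf, fun i => ?_⟩
    rw [hskew, hfν, hae]
    simp [hgε, Pi.single_apply, eq_comm]
  choose f₀ hf₀a hf₀b using hf₀
  -- The vectors `f₀` are dual to `ε` but need not be isotropic. Subtracting half of the Gram matrix
  -- along the isotropic `ε` keeps the duality and makes `b (f i) (f j)` vanish.
  set f : Fin (m + 1) → F := fun j => f₀ j - (2⁻¹ : 𝕜) • ∑ k, b (f₀ j) (f₀ k) • ε k with hf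
  have hfa : ∀ j, a (f j) = 0 := fun j => by simp [hf, hf₀a, hae]
  have hεf : ∀ i j, b (ε i) (f j) = if i = j then 1 else 0 := fun i j => by
    simp [hf, hbe', hf₀b]
  have hfε : ∀ i j, b (f i) (ε j) = -if j = i then 1 else 0 := fun i j => by
    rw [hskew, hεf]
  have hff : ∀ i j, b (f i) (f j) = 0 := by
    intro i j
    have h1 : b (f i) (f j) = b (f i) (f₀ j) - 2⁻¹ * ∑ k, b (f₀ j) (f₀ k) * b (f i) (ε k) := by
      rw [show f j = f₀ j - (2⁻¹ : 𝕜) • ∑ k, b (f₀ j) (f₀ k) • ε k from rfl]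
      simp only [map_sub, map_smul, map_sum, smul_eq_mul]
    have h2 : b (f i) (f₀ j) = b (f₀ i) (f₀ j) - 2⁻¹ * ∑ k, b (f₀ i) (f₀ k) * b (ε k) (f₀ j) := by
      rw [show f i = f₀ i - (2⁻¹ : 𝕜) • ∑ k, b (f₀ i) (f₀ k) • ε k from rfl]
      simp
    rw [h1, h2]
    simp only [hfε, hf₀b]
    simp
    rw [hskew (f₀ j) (f₀ i)]
    ring
  -- The inverse of the desired coordinates. Its components are recovered by pairing with `ε` and
  -- `f` and by evaluating `a`, which proves injectivity.
  set S : DarbouxSpace 𝕜 (m + 1) →ₗ[𝕜] F :=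
    { toFun := fun z => ∑ i, z.2.1 i • ε i + ∑ i, z.1 i • f i + z.2.2 • R
      map_add' := fun z z' => by
        simp only [Prod.snd_add, Prod.fst_add, Pi.add_apply, add_smul, Finset.sum_add_distrib]
        abel
      map_smul' := fun c z => by
        simp [mul_smul, Finset.smul_sum] } with hS
  have hSapply : ∀ z, S z = ∑ i, z.2.1 i • ε i + ∑ i, z.1 i • f i + z.2.2 • R := fun z => rfl
  have hSa : ∀ z, a (S z) = z.2.2 := fun z => by simp [hSapply, hae, hfa, hRa]
  have hSε : ∀ i z, b (ε i) (S z) = z.1 i := fun i z => by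
    simp [hSapply, hbe', hεf, hskew (ε i) R, hR]
  have hSf : ∀ i z, b (f i) (S z) = -z.2.1 i := fun i z => by
    simp [hSapply, hfε, hff, hskew (f i) R, hR]
  have hSS : ∀ z z', b (S z) (S z') = ∑ i, (z.2.1 i * z'.1 i - z.1 i * z'.2.1 i) := by
    intro z z'
    rw [hSapply z]
    simp [hSε, hSf, hR, Finset.sum_add_distrib, sub_eq_add_neg]
  have hinj : Function.Injective S := by
    rw [injective_iff_map_eq_zero]
    intro z hz
    refine Prod.ext (funext fun i => ?_) (Prod.ext (funext fun i => ?_) ?_)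
    · rw [← hSε, hz]; simp
    · have := hSf i z
      rw [hz, map_zero, zero_eq_neg] at this
      exact this
    · rw [← hSa, hz]; simp
  have hfin : Module.finrank 𝕜 (DarbouxSpace 𝕜 (m + 1)) = Module.finrank 𝕜 F := by
    rw [hF]; simp; ring
  set T := (S.linearEquivOfInjective hinj hfin).toContinuousLinearEquiv.symm with hT
  have hST : ∀ v, S (T v) = v := fun v => (S.linearEquivOfInjective hinj hfin).apply_symm_apply v
  refine ⟨T, fun v => by rw [← hSa, hST], fun v w => by rw [← hSS, hST, hST], fun i j => ?_⟩
  have h1 := hSf j (T (e i))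
  rw [hST] at h1
  rw [eq_neg_iff_add_eq_zero, add_comm, ← eq_neg_iff_add_eq_zero] at h1
  rw [h1, show e i = ε i.castSucc by simp [hε], hfε]
  simp [Pi.single_apply, eq_comm]

end SymplecticBasis

/-! ### Darboux coordinates adapted to an isotropic family -/

section Darboux

set_option maxSynthPendingDepth 3

variable {𝕜 : Type*} [RCLike 𝕜] {F : Type*} [NormedAddCommGroup F] [NormedSpace 𝕜 F]

/-- The first-order expansion of a contact form is the pull-back of the standard form under a
quadratic map. -/
theorem exists_pullback_eq_linearization {m : ℕ} {α : F → F →L[𝕜] 𝕜}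
    (T : F →L[𝕜] DarbouxSpace 𝕜 (m + 1)) (hTr : ∀ v, (T v).2.2 = α 0 v)
    (hT : ∀ v w, dForm α 0 v w = ∑ i, ((T v).2.1 i * (T w).1 i - (T v).1 i * (T w).2.1 i)) :
    ∃ ψ : F → DarbouxSpace 𝕜 (m + 1), ContDiff 𝕜 ∞ ψ ∧ ψ 0 = 0 ∧ HasFDerivAt ψ T 0 ∧
      ∀ x v, stdForm 𝕜 (m + 1) (ψ x) (fderiv 𝕜 ψ x v) = (α 0 + fderiv 𝕜 α 0 x) v := by
  -- Adding p(x) · q(v) cancels the antisymmetric part of the derivative of `α`. So `S x ·` is the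
  -- differential of `½ S x x`, and adding this quadratic function to the `r`-coordinate of `T`
  -- gives `ψ`.
  set S : F → F → 𝕜 := fun x v => fderiv 𝕜 α 0 x v + ∑ i, (T x).1 i * (T v).2.1 i with hS
  have hsymm : ∀ x v, S x v = S v x := by
    intro x v
    have h := hT x v
    rw [dForm, Finset.sum_sub_distrib] at h
    simp only [hS]
    simp_rw [mul_comm ((T v).1 _)]
    linear_combination h
  set P : Fin (m + 1) → F →L[𝕜] 𝕜 := fun i => (ContinuousLinearMap.proj i).comp
    ((ContinuousLinearMap.fst 𝕜 (Fin (m + 1) → 𝕜) ((Fin (m + 1) → 𝕜) × 𝕜)).comp T) with hP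
  set Q : Fin (m + 1) → F →L[𝕜] 𝕜 := fun i => (ContinuousLinearMap.proj i).comp
    ((ContinuousLinearMap.fst 𝕜 (Fin (m + 1) → 𝕜) 𝕜).comp
    ((ContinuousLinearMap.snd 𝕜 (Fin (m + 1) → 𝕜) ((Fin (m + 1) → 𝕜) × 𝕜)).comp T)) with hQ
  set ι : 𝕜 →L[𝕜] DarbouxSpace 𝕜 (m + 1) := (ContinuousLinearMap.inr 𝕜 _ _).comp
    (ContinuousLinearMap.inr 𝕜 (Fin (m + 1) → 𝕜) 𝕜) with hι
  have hquad : ∀ x, HasFDerivAt (fun x => S x x)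
      ((fderiv 𝕜 α 0 x + (fderiv 𝕜 α 0).flip x) + ∑ i, (P i x • Q i + Q i x • P i)) x := by
    intro x
    refine HasFDerivAt.add ?_ (HasFDerivAt.fun_sum fun i _ =>
      ((P i).hasFDerivAt (x := x)).mul ((Q i).hasFDerivAt (x := x)))
    refine ((fderiv 𝕜 α 0).hasFDerivAt.clm_apply (hasFDerivAt_id x)).congr_fderiv ?_
    ext v
    simp
  have hψd : ∀ x, HasFDerivAt (fun x => T x + ι (2⁻¹ * S x x)) _ x := fun x =>
    T.hasFDerivAt.add (ι.hasFDerivAt.comp x ((hquad x).const_mul 2⁻¹))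
  have hval : ∀ x v, ((fderiv 𝕜 α 0 x + (fderiv 𝕜 α 0).flip x) +
      ∑ i, (P i x • Q i + Q i x • P i)) v = 2 * S x v := by
    intro x v
    have h : 2 * S x v = S x v + S v x := by rw [hsymm v x]; ring
    rw [h]
    simp [hS, hP, hQ, Finset.sum_add_distrib, mul_comm]
    ring
  have hfd : ∀ x v, fderiv 𝕜 (fun x => T x + ι (2⁻¹ * S x x)) x v = T v + ι (S x v) := by
    intro x v
    rw [(hψd x).fderiv]
    exact congrArg (fun s => T v + ι s) ((congrArg ((2⁻¹ : 𝕜) * ·) (hval x v)).trans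
      (inv_mul_cancel_left₀ two_ne_zero _))
  refine ⟨fun x => T x + ι (2⁻¹ * S x x), ?_, ?_, ?_, ?_⟩
  · refine T.contDiff.add (ι.contDiff.comp (contDiff_const.mul ?_))
    exact ((fderiv 𝕜 α 0).contDiff.clm_apply contDiff_id).add
      (ContDiff.sum fun i _ => (P i).contDiff.mul (Q i).contDiff)
  · simp [hS]
  · refine (hψd 0).congr_fderiv ?_
    rw [← (hψd 0).fderiv]
    ext1 v
    rw [hfd]
    simp [hS]
  · intro x v
    rw [hfd, stdForm_apply]
    simp [hι, hS, hTr]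
    ring

/-- Darboux's theorem for contact forms, with coordinates adapted to an isotropic family of
vectors. -/
theorem exists_darboux_germ [FiniteDimensional 𝕜 F] {m : ℕ} (hF : Module.finrank 𝕜 F = 2 * (m + 1) + 1)
    {α : F → F →L[𝕜] 𝕜} {y₀ : F} (hα : ∀ᶠ y in 𝓝 y₀, ContDiffAt 𝕜 ∞ α y)
    (hc : IsContactFormAt α y₀) {e : Fin m → F} (he : LinearIndependent 𝕜 e)
    (ha : ∀ i, α y₀ (e i) = 0) (hbe : ∀ i j, dForm α y₀ (e i) (e j) = 0) :
    ∃ (τ : F → DarbouxSpace 𝕜 (m + 1)) (T : F ≃L[𝕜] DarbouxSpace 𝕜 (m + 1)),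
      (∀ᶠ y in 𝓝 y₀, ContDiffAt 𝕜 ∞ τ y) ∧ τ y₀ = 0 ∧
      HasFDerivAt τ (T : F →L[𝕜] DarbouxSpace 𝕜 (m + 1)) y₀ ∧
      (∀ i j, (T (e i)).2.1 j = (Pi.single i.castSucc 1 : Fin (m + 1) → 𝕜) j) ∧
      ∀ᶠ y in 𝓝 y₀, ∀ v, α y v = 0 → stdForm 𝕜 (m + 1) (τ y) (fderiv 𝕜 τ y v) = 0 := by
  set α' : F → F →L[𝕜] 𝕜 := fun y => α (y + y₀) with hα'
  have htr : Tendsto (fun y => y - y₀) (𝓝 y₀) (𝓝 0) := by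
    have : ContinuousAt (fun y => y - y₀) y₀ := by fun_prop
    simpa [ContinuousAt] using this
  have htr' : Tendsto (fun y => y + y₀) (𝓝 0) (𝓝 y₀) := by
    have : ContinuousAt (fun y => y + y₀) 0 := by fun_prop
    simpa [ContinuousAt] using this
  have hα'0 : α' 0 = α y₀ := by simp [hα']
  have hα'd : fderiv 𝕜 α' 0 = fderiv 𝕜 α y₀ := by simp [hα', fderiv_comp_add_right]
  have hdF : ∀ v w, dForm α' 0 v w = dForm α y₀ v w := fun v w => by rw [dForm, dForm, hα'd]
  have hc' : IsContactFormAt α' 0 := by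
    simpa only [IsContactFormAt, hdF, hα'0] using hc
  have hαs : ∀ᶠ y in 𝓝 0, ContDiffAt 𝕜 ∞ α' y := by
    filter_upwards [htr'.eventually hα] with y hy
    exact hy.comp y (contDiffAt_id.add contDiffAt_const)
  obtain ⟨T, hTr, hT, hTe⟩ := exists_darboux_equiv hF hc' he (by simpa only [hα'0] using ha)
    (by simpa only [hdF] using hbe)
  obtain ⟨ψ, hψs, hψ0, hψd, hψ⟩ := exists_pullback_eq_linearization (α := α')
    (T : F →L[𝕜] DarbouxSpace 𝕜 (m + 1)) hTr hT
  obtain ⟨φ, hφs, hφ0, hφd, hφ⟩ := exists_map_ker_linearization hαs hc'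
  have hsub : ∀ y, HasFDerivAt (fun y : F => y - y₀) (ContinuousLinearMap.id 𝕜 F) y := fun y =>
    (hasFDerivAt_id y).sub_const y₀
  refine ⟨fun y => ψ (φ (y - y₀)), T, ?_, by simp [hφ0, hψ0], ?_, hTe, ?_⟩
  · filter_upwards [htr.eventually hφs] with y hy
    exact hψs.contDiffAt.comp y (hy.comp y (contDiffAt_id.sub contDiffAt_const))
  -- As `φ` is tangent to the identity, the differential of `τ` is `T` itself, and the adaptation to
  -- the vectors `e i` survives.
  · have h1 : HasFDerivAt φ (ContinuousLinearMap.id 𝕜 F) (y₀ - y₀) := by rwa [sub_self]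
    have h2 : HasFDerivAt ψ (T : F →L[𝕜] DarbouxSpace 𝕜 (m + 1)) (φ (y₀ - y₀)) := by
      rwa [sub_self, hφ0]
    exact HasFDerivAt.comp (f := fun y => φ (y - y₀)) y₀ h2
      (HasFDerivAt.comp (f := fun y => y - y₀) y₀ h1 (hsub y₀))
  · filter_upwards [htr.eventually hφs, htr.eventually hφ] with y hy hy' v hv
    have h1 := ((hψs.differentiable (by simp)) (φ (y - y₀))).hasFDerivAt.comp y
      ((hy.differentiableAt (by simp)).hasFDerivAt.comp y (hsub y))
    have h2 : fderiv 𝕜 (fun y => ψ (φ (y - y₀))) y v =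
        fderiv 𝕜 ψ (φ (y - y₀)) (fderiv 𝕜 φ (y - y₀) v) := by
      rw [show (fun y => ψ (φ (y - y₀))) = ψ ∘ φ ∘ (fun y => y - y₀) from rfl, h1.fderiv]
      rfl
    rw [h2, hψ]
    exact hy' v (by simpa [hα'] using hv)

end Darboux

/-! ### Integration in the last variable -/

section PreNormal

variable {𝕜 : Type*} [RCLike 𝕜] {m : ℕ}

variable (𝕜 m) in
/-- The projection of `𝕜^{m+1}` to the hyperplane where the last coordinate vanishes. -/
def dropLast : (Fin (m + 1) → 𝕜) →L[𝕜] (Fin (m + 1) → 𝕜) :=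
  ContinuousLinearMap.id 𝕜 _ -
    (ContinuousLinearMap.proj (R := 𝕜) (φ := fun _ : Fin (m + 1) => 𝕜) (Fin.last m)).smulRight
      (Pi.single (Fin.last m) (1 : 𝕜) : Fin (m + 1) → 𝕜)

theorem dropLast_apply (x : Fin (m + 1) → 𝕜) : dropLast 𝕜 m x = Function.update x (Fin.last m) 0 := by
  ext i
  refine Fin.lastCases ?_ (fun i => ?_) i
  · simp [dropLast]
  · simp [dropLast, Fin.castSucc_ne_last]

@[simp] theorem dropLast_single_last (c : 𝕜) :
    dropLast 𝕜 m (Pi.single (Fin.last m) c) = 0 := by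
  rw [dropLast_apply, Pi.single, Function.update_idem]; exact Function.update_eq_self _ _

@[simp] theorem dropLast_single_castSucc (i : Fin m) (c : 𝕜) :
    dropLast 𝕜 m (Pi.single i.castSucc c) = Pi.single i.castSucc c := by
  rw [dropLast_apply, Function.update_eq_self_iff]
  simp [Fin.castSucc_ne_last]

theorem update_last_eq (x : Fin (m + 1) → 𝕜) (s : 𝕜) :
    Function.update x (Fin.last m) s = dropLast 𝕜 m x + s • Pi.single (Fin.last m) 1 := by
  ext i
  refine Fin.lastCases ?_ (fun i => ?_) i
  · simp [dropLast_apply]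
  · simp [dropLast_apply, Fin.castSucc_ne_last]

/-- Balls of the sup norm are products of discs, so shrinking one coordinate does not leave them.
This keeps the segments of integration, and the projection to xₙ = 0, in the domain. -/
theorem update_last_mem_ball {x : Fin (m + 1) → 𝕜} {ρ : ℝ} (hx : x ∈ Metric.ball 0 ρ) {t : ℝ}
    (ht : t ∈ Set.Icc (0 : ℝ) 1) :
    Function.update x (Fin.last m) (t * x (Fin.last m)) ∈ Metric.ball (0 : Fin (m + 1) → 𝕜) ρ := by
  rw [mem_ball_zero_iff] at hx ⊢
  refine lt_of_le_of_lt ((pi_norm_le_iff_of_nonneg (norm_nonneg x)).2 fun i => ?_) hx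
  refine Fin.lastCases ?_ (fun i => ?_) i
  · rw [Function.update_self, norm_mul, RCLike.norm_ofReal, abs_of_nonneg ht.1]
    exact (mul_le_of_le_one_left (norm_nonneg _) ht.2).trans (norm_le_pi_norm x _)
  · rw [Function.update_of_ne (Fin.castSucc_ne_last i)]
    exact norm_le_pi_norm x _

theorem dropLast_mem_ball {x : Fin (m + 1) → 𝕜} {ρ : ℝ} (hx : x ∈ Metric.ball 0 ρ) :
    dropLast 𝕜 m x ∈ Metric.ball (0 : Fin (m + 1) → 𝕜) ρ := by
  have := update_last_mem_ball hx (t := 0) ⟨le_rfl, zero_le_one⟩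
  rwa [RCLike.ofReal_zero, zero_mul, ← dropLast_apply] at this

/-- The fundamental theorem of calculus in the last variable. -/
theorem lastIntegral_eq_sub {G g : (Fin (m + 1) → 𝕜) → 𝕜} {ρ : ℝ}
    (hG : DifferentiableOn 𝕜 G (Metric.ball 0 ρ))
    (hg : ∀ y ∈ Metric.ball 0 ρ, partialDeriv (Fin.last m) G y = g y)
    (hgc : ContinuousOn g (Metric.ball 0 ρ)) {x : Fin (m + 1) → 𝕜} (hx : x ∈ Metric.ball 0 ρ) :
    lastIntegral g x = G x - G (dropLast 𝕜 m x) := by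
  set l : ℝ → Fin (m + 1) → 𝕜 := fun t => Function.update x (Fin.last m) (t * x (Fin.last m))
    with hl
  have hld : ∀ t, HasDerivAt l (x (Fin.last m) • Pi.single (Fin.last m) 1) t := by
    intro t
    have h1 : HasDerivAt (fun t : ℝ => (t : 𝕜) * x (Fin.last m)) (1 * x (Fin.last m)) t := by
      simpa using ((RCLike.ofRealCLM (K := 𝕜)).hasDerivAt (x := t)).mul_const (x (Fin.last m))
    have h2 := (h1.smul_const (Pi.single (Fin.last m) 1 : Fin (m + 1) → 𝕜)).const_add
      (dropLast 𝕜 m x)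
    rw [one_mul] at h2
    exact h2.congr_of_eventuallyEq (Eventually.of_forall fun t => update_last_eq _ _)
  have hlb : ∀ t ∈ Set.Icc (0 : ℝ) 1, l t ∈ Metric.ball (0 : Fin (m + 1) → 𝕜) ρ := fun t ht =>
    update_last_mem_ball hx ht
  have h3 : ∀ t ∈ Set.uIcc (0 : ℝ) 1,
      HasDerivAt (fun t => G (l t)) (x (Fin.last m) * g (l t)) t := by
    intro t ht
    rw [Set.uIcc_of_le zero_le_one] at ht
    have h4 := ((hG.differentiableAt (Metric.isOpen_ball.mem_nhds
      (hlb t ht))).hasFDerivAt.restrictScalars ℝ).comp_hasDerivAt t (hld t)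
    refine h4.congr_deriv ?_
    change fderiv 𝕜 G (l t) (x (Fin.last m) • Pi.single (Fin.last m) 1) = _
    rw [map_smul, smul_eq_mul, ← hg _ (hlb t ht), partialDeriv]
  have hcont : ContinuousOn (fun t => x (Fin.last m) * g (l t)) (Set.uIcc (0 : ℝ) 1) := by
    rw [Set.uIcc_of_le zero_le_one]
    exact continuousOn_const.mul (hgc.comp (fun t _ => (hld t).continuousAt.continuousWithinAt) hlb)
  have h5 := intervalIntegral.integral_eq_sub_of_hasDerivAt h3 hcont.intervalIntegrable
  rw [lastIntegral, h5]
  simp [hl, dropLast_apply]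

end PreNormal

/-! ### Recovering the map from `u` and `v` -/

section Normalize

variable {𝕜 : Type*} [RCLike 𝕜] {m : ℕ}

theorem stdForm_fderiv {E : Type*} [NormedAddCommGroup E] [NormedSpace 𝕜 E]
    {k : E → DarbouxSpace 𝕜 (m + 1)} {x : E} (hk : DifferentiableAt 𝕜 k x) (w : E)
    (z : DarbouxSpace 𝕜 (m + 1)) :
    stdForm 𝕜 (m + 1) z (fderiv 𝕜 k x w) = fderiv 𝕜 (fun x => (k x).2.2) x w -
      ∑ i, z.1 i * fderiv 𝕜 (fun x => (k x).2.1 i) x w := by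
  rw [stdForm_apply]
  have h := hk.hasFDerivAt
  have h1 : fderiv 𝕜 (fun x => (k x).2.2) x w = (fderiv 𝕜 k x w).2.2 := by
    rw [(h.snd.snd).fderiv]; rfl
  have h2 : ∀ i, fderiv 𝕜 (fun x => (k x).2.1 i) x w = (fderiv 𝕜 k x w).2.1 i := fun i => by
    rw [((hasFDerivAt_pi'.1 h.snd.fst) i).fderiv]; rfl
  simp [h1, h2]

/-- An integral map-germ whose first `q`-coordinates are the first coordinates of the source, and
whose coordinates `qₙ` and `r` vanish where `xₙ = 0`, is determined by `qₙ` and `pₙ`. -/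
theorem eventuallyEq_preNormal {k : (Fin (m + 1) → 𝕜) → DarbouxSpace 𝕜 (m + 1)}
    (hk : ∀ᶠ x in 𝓝 0, ContDiffAt 𝕜 ∞ k x)
    (hint : ∀ᶠ x in 𝓝 0, ∀ v, stdForm 𝕜 (m + 1) (k x) (fderiv 𝕜 k x v) = 0)
    (hq : ∀ᶠ x in 𝓝 0, ∀ i : Fin m, (k x).2.1 i.castSucc = x i.castSucc)
    (hq0 : ∀ᶠ x in 𝓝 0, (k (dropLast 𝕜 m x)).2.1 (Fin.last m) = 0)
    (hr0 : ∀ᶠ x in 𝓝 0, (k (dropLast 𝕜 m x)).2.2 = 0) :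
    k =ᶠ[𝓝 0] preNormal (fun x => (k x).2.1 (Fin.last m)) (fun x => (k x).1 (Fin.last m)) := by
  obtain ⟨ρ, hρ, hball⟩ := Metric.eventually_nhds_iff_ball.1
    (hk.and (hint.and (hq.and (hq0.and hr0))))
  set B := Metric.ball (0 : Fin (m + 1) → 𝕜) ρ
  have hB : ∀ x ∈ B, B ∈ 𝓝 x := fun x hx => Metric.isOpen_ball.mem_nhds hx
  set u : (Fin (m + 1) → 𝕜) → 𝕜 := fun x => (k x).2.1 (Fin.last m) with hu
  set v : (Fin (m + 1) → 𝕜) → 𝕜 := fun x => (k x).1 (Fin.last m) with hv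
  set r : (Fin (m + 1) → 𝕜) → 𝕜 := fun x => (k x).2.2 with hr
  have hks : ContDiffOn 𝕜 ∞ k B := fun x hx => (hball x hx).1.contDiffWithinAt
  have hus : ContDiffOn 𝕜 ∞ u B := contDiffOn_pi.1 hks.snd.fst _
  have hvs : ContDiffOn 𝕜 ∞ v B := contDiffOn_pi.1 hks.fst _
  have hrs : ContDiffOn 𝕜 ∞ r B := hks.snd.snd
  have hps : ∀ i, ContDiffOn 𝕜 ∞ (fun x => (k x).1 i) B := fun i => contDiffOn_pi.1 hks.fst i
  have hpd : ∀ {g : (Fin (m + 1) → 𝕜) → 𝕜}, ContDiffOn 𝕜 ∞ g B → ∀ i,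
      ContDiffOn 𝕜 ∞ (partialDeriv i g) B := fun hg i =>
    (hg.fderiv_of_isOpen Metric.isOpen_ball (by simp)).clm_apply contDiffOn_const
  have hdiff : ∀ {g : (Fin (m + 1) → 𝕜) → 𝕜}, ContDiffOn 𝕜 ∞ g B → ∀ x ∈ B,
      DifferentiableAt 𝕜 g x := fun hg x hx =>
    (hg.contDiffAt (hB x hx)).differentiableAt (by simp)
  have hsymm : ∀ {g : (Fin (m + 1) → 𝕜) → 𝕜}, ContDiffOn 𝕜 ∞ g B → ∀ i j, ∀ x ∈ B,
      partialDeriv i (partialDeriv j g) x = partialDeriv j (partialDeriv i g) x := by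
    intro g hg i j x hx
    have h1 : IsSymmSndFDerivAt 𝕜 g x := (hg.contDiffAt (hB x hx)).isSymmSndFDerivAt
      (by rw [minSmoothness_of_isRCLikeNormedField]; exact ENat.LEInfty.out)
    have h2 : ∀ a b, partialDeriv a (partialDeriv b g) x =
        fderiv 𝕜 (fderiv 𝕜 g) x (Pi.single a 1) (Pi.single b 1) := fun a b => by
      have h3 : DifferentiableAt 𝕜 (fderiv 𝕜 g) x :=
        ((hg.fderiv_of_isOpen (m := ∞) Metric.isOpen_ball (by simp)).contDiffAt
          (hB x hx)).differentiableAt (by simp)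
      have h4 := (h3.hasFDerivAt.clm_apply
        (hasFDerivAt_const (Pi.single b 1 : Fin (m + 1) → 𝕜) x)).fderiv
      change fderiv 𝕜 (fun y => fderiv 𝕜 g y (Pi.single b 1)) x (Pi.single a 1) = _
      rw [h4]
      simp
    rw [h2, h2, h1.eq]
  have hform : ∀ x ∈ B, ∀ w, fderiv 𝕜 r x w =
      ∑ i : Fin m, (k x).1 i.castSucc * w i.castSucc + v x * fderiv 𝕜 u x w := by
    intro x hx w
    have h1 := (hball x hx).2.1 w
    rw [stdForm_fderiv ((hball x hx).1.differentiableAt (by simp)), Fin.sum_univ_castSucc] at h1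
    have h2 : ∀ i : Fin m, fderiv 𝕜 (fun x => (k x).2.1 i.castSucc) x w = w i.castSucc := by
      intro i
      have h3 : (fun x => (k x).2.1 i.castSucc) =ᶠ[𝓝 x] fun x => x i.castSucc := by
        filter_upwards [hB x hx] with y hy using (hball y hy).2.2.1 i
      rw [h3.fderiv_eq, (hasFDerivAt_apply i.castSucc x).fderiv]
      rfl
    simp only [h2] at h1
    linear_combination h1
  have hrn : ∀ x ∈ B, partialDeriv (Fin.last m) r x = v x * partialDeriv (Fin.last m) u x := by
    intro x hx
    rw [partialDeriv, hform x hx, partialDeriv]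
    simp [Fin.castSucc_ne_last]
  have hri : ∀ i : Fin m, ∀ x ∈ B, partialDeriv i.castSucc r x =
      (k x).1 i.castSucc + v x * partialDeriv i.castSucc u x := by
    intro i x hx
    rw [partialDeriv, hform x hx, partialDeriv]
    simp [Pi.single_apply]
  have hdrop : ∀ x ∈ B, dropLast 𝕜 m x ∈ B := fun x hx => dropLast_mem_ball hx
  have hzero : ∀ {g : (Fin (m + 1) → 𝕜) → 𝕜}, ContDiffOn 𝕜 ∞ g B →
      (∀ x ∈ B, g (dropLast 𝕜 m x) = 0) → ∀ i : Fin m, ∀ x ∈ B,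
      partialDeriv i.castSucc g (dropLast 𝕜 m x) = 0 := by
    intro g hg h0 i x hx
    have h1 : HasFDerivAt (fun x => g (dropLast 𝕜 m x)) _ x :=
      (hdiff hg _ (hdrop x hx)).hasFDerivAt.comp x (dropLast 𝕜 m).hasFDerivAt
    have h2 : HasFDerivAt (fun x => g (dropLast 𝕜 m x)) (0 : (Fin (m + 1) → 𝕜) →L[𝕜] 𝕜) x :=
      (hasFDerivAt_const (0 : 𝕜) x).congr_of_eventuallyEq
        (by filter_upwards [hB x hx] with y hy using h0 y hy)
    have h3 := DFunLike.congr_fun (h1.unique h2) (Pi.single i.castSucc 1)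
    simpa [partialDeriv] using h3
  -- Where xₙ = 0, the functions `r` and `u` vanish together with their tangential derivatives, and
  -- pᵢ = ∂r/∂xᵢ - v ∂u/∂xᵢ.
  have hp0 : ∀ i : Fin m, ∀ x ∈ B, (k (dropLast 𝕜 m x)).1 i.castSucc = 0 := by
    intro i x hx
    have h1 := hri i _ (hdrop x hx)
    rw [hzero hrs (fun x hx => (hball x hx).2.2.2.2) i x hx,
      hzero hus (fun x hx => (hball x hx).2.2.2.1) i x hx] at h1
    simpa using h1.symm
  have hpn : ∀ i : Fin m, ∀ x ∈ B, partialDeriv (Fin.last m) (fun x => (k x).1 i.castSucc) x =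
      partialDeriv i.castSucc v x * partialDeriv (Fin.last m) u x -
        partialDeriv (Fin.last m) v x * partialDeriv i.castSucc u x := by
    intro i x hx
    have hmul : ∀ a b, partialDeriv a (fun x => v x * partialDeriv b u x) x =
        v x * partialDeriv a (partialDeriv b u) x + partialDeriv a v x * partialDeriv b u x := by
      intro a b
      rw [partialDeriv, fderiv_fun_mul (hdiff hvs x hx) (hdiff (hpd hus b) x hx)]
      simp [partialDeriv, mul_comm]
    have h1 : (fun x => (k x).1 i.castSucc) =ᶠ[𝓝 x]
        fun x => partialDeriv i.castSucc r x - v x * partialDeriv i.castSucc u x := by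
      filter_upwards [hB x hx] with y hy
      rw [hri i y hy]; ring
    have h3 : partialDeriv (Fin.last m) r =ᶠ[𝓝 x]
        fun x => v x * partialDeriv (Fin.last m) u x := by
      filter_upwards [hB x hx] with y hy using hrn y hy
    have h4 : partialDeriv (Fin.last m) (fun x => (k x).1 i.castSucc) x =
        partialDeriv (Fin.last m) (partialDeriv i.castSucc r) x -
          partialDeriv (Fin.last m) (fun x => v x * partialDeriv i.castSucc u x) x := by
      rw [partialDeriv, h1.fderiv_eq, fderiv_fun_sub (hdiff (hpd hrs _) x hx)
        (hdiff (hvs.mul (hpd hus _)) x hx)]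
      rfl
    have h5 : partialDeriv i.castSucc (partialDeriv (Fin.last m) r) x =
        partialDeriv i.castSucc (fun x => v x * partialDeriv (Fin.last m) u x) x := by
      rw [partialDeriv, h3.fderiv_eq]; rfl
    -- Exchanging the mixed partials of `r` and `u` cancels the two terms `v ∂²u/∂xᵢ∂xₙ`.
    rw [h4, hsymm hrs _ _ x hx, h5, hmul, hmul, hsymm hus _ _ x hx]
    ring
  filter_upwards [hB 0 (Metric.mem_ball_self hρ)] with x hx
  refine Prod.ext (funext fun i => ?_) (Prod.ext (funext fun i => ?_) ?_)
  · refine Fin.lastCases ?_ (fun i => ?_) i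
    · simp [preNormal, hv]
    · simp only [preNormal, Fin.snoc_castSucc]
      rw [lastIntegral_eq_sub (G := fun x => (k x).1 i.castSucc) (ρ := ρ)
        (fun x hx => (hdiff (hps _) x hx).differentiableWithinAt) (hpn i)
        (((hpd hvs _).mul (hpd hus _)).sub ((hpd hvs _).mul (hpd hus _))).continuousOn hx,
        hp0 i x hx, sub_zero]
  · refine Fin.lastCases ?_ (fun i => ?_) i
    · simp [preNormal, hu]
    · simp only [preNormal, Fin.snoc_castSucc]
      exact (hball x hx).2.2.1 i
  · rw [preNormal, lastIntegral_eq_sub (G := r) (ρ := ρ)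
        (fun x hx => (hdiff hrs x hx).differentiableWithinAt) hrn
        (hvs.mul (hpd hus _)).continuousOn hx]
    have h0 : r (dropLast 𝕜 m x) = 0 := (hball x hx).2.2.2.2
    rw [h0, sub_zero]

end Normalize

/-! ### Contact transformations that shift qₙ and r -/

section Shear

variable {𝕜 : Type*} [RCLike 𝕜] {m : ℕ}

/-- The gradient of a function on `𝕜ⁿ`. -/
def grad {n : ℕ} (A : (Fin n → 𝕜) → 𝕜) (q : Fin n → 𝕜) : Fin n → 𝕜 := fun i => partialDeriv i A q

theorem fderiv_apply_eq_sum_grad {n : ℕ} (A : (Fin n → 𝕜) → 𝕜) (q w : Fin n → 𝕜) :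
    fderiv 𝕜 A q w = ∑ i, grad A q i * w i := by
  conv_lhs => rw [pi_eq_sum_univ' w]
  simp only [map_sum, map_smul, smul_eq_mul, grad, partialDeriv]
  refine Finset.sum_congr rfl fun i _ => ?_
  rw [mul_comm]

/-- The contact transformation of `𝕜^{2n+1}` which subtracts `A(q)` from `qₙ` and `G(q)` from `r`. -/
def shear (A G : (Fin (m + 1) → 𝕜) → 𝕜) (z : DarbouxSpace 𝕜 (m + 1)) : DarbouxSpace 𝕜 (m + 1) :=
  (z.1 + z.1 (Fin.last m) • grad A z.2.1 - grad G z.2.1,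
    z.2.1 - A z.2.1 • Pi.single (Fin.last m) 1, z.2.2 - G z.2.1)

theorem contDiffAt_grad {A : (Fin (m + 1) → 𝕜) → 𝕜} {q : Fin (m + 1) → 𝕜}
    (hA : ContDiffAt 𝕜 ∞ A q) : ContDiffAt 𝕜 ∞ (grad A) q :=
  contDiffAt_pi.2 fun _ => (hA.fderiv_right (m := ∞) (by simp)).clm_apply contDiffAt_const

theorem contDiffAt_shear {A G : (Fin (m + 1) → 𝕜) → 𝕜} {z : DarbouxSpace 𝕜 (m + 1)}
    (hA : ContDiffAt 𝕜 ∞ A z.2.1) (hG : ContDiffAt 𝕜 ∞ G z.2.1) :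
    ContDiffAt 𝕜 ∞ (shear A G) z := by
  have h1 : ContDiffAt 𝕜 ∞ (fun z : DarbouxSpace 𝕜 (m + 1) => z.1) z := contDiffAt_fst
  have h2 : ContDiffAt 𝕜 ∞ (fun z : DarbouxSpace 𝕜 (m + 1) => z.2.1) z :=
    contDiffAt_fst.comp z contDiffAt_snd
  have h3 : ContDiffAt 𝕜 ∞ (fun z : DarbouxSpace 𝕜 (m + 1) => z.2.2) z :=
    contDiffAt_snd.comp z contDiffAt_snd
  exact ((h1.add ((contDiffAt_pi.1 h1 _).smul ((contDiffAt_grad hA).comp z h2))).sub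
    ((contDiffAt_grad hG).comp z h2)).prodMk
    ((h2.sub ((hA.comp z h2).smul contDiffAt_const)).prodMk (h3.sub (hG.comp z h2)))

theorem grad_last {A : (Fin (m + 1) → 𝕜) → 𝕜} (hA : ∀ q, A (dropLast 𝕜 m q) = A q)
    {q : Fin (m + 1) → 𝕜} (h : DifferentiableAt 𝕜 A q) : grad A q (Fin.last m) = 0 := by
  have h1 := h.hasFDerivAt.hasLineDerivAt (Pi.single (Fin.last m) 1)
  have h2 : HasLineDerivAt 𝕜 A 0 q (Pi.single (Fin.last m) 1) := by
    refine (hasDerivAt_const (0 : 𝕜) (A q)).congr_of_eventuallyEq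
      (Eventually.of_forall fun t => ?_)
    change A (q + t • Pi.single (Fin.last m) 1) = A q
    rw [← hA, map_add, map_smul, dropLast_single_last, smul_zero, add_zero, hA]
  exact HasDerivAt.unique h1 h2

theorem shear_fst_last {A G : (Fin (m + 1) → 𝕜) → 𝕜} (hA : ∀ q, A (dropLast 𝕜 m q) = A q)
    (hG : ∀ q, G (dropLast 𝕜 m q) = G q) {z : DarbouxSpace 𝕜 (m + 1)}
    (hAd : DifferentiableAt 𝕜 A z.2.1) (hGd : DifferentiableAt 𝕜 G z.2.1) :
    (shear A G z).1 (Fin.last m) = z.1 (Fin.last m) := by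
  simp [shear, grad_last hA hAd, grad_last hG hGd]

/-- Only these components of the differential enter the standard form, so the derivatives of `grad
A` and `grad G` are not needed for the invariance. -/
theorem fderiv_shear_snd {A G : (Fin (m + 1) → 𝕜) → 𝕜} {z : DarbouxSpace 𝕜 (m + 1)}
    (hA : ContDiffAt 𝕜 ∞ A z.2.1) (hG : ContDiffAt 𝕜 ∞ G z.2.1) (w : DarbouxSpace 𝕜 (m + 1)) :
    (fderiv 𝕜 (shear A G) z w).2 =
      (w.2.1 - fderiv 𝕜 A z.2.1 w.2.1 • Pi.single (Fin.last m) 1,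
        w.2.2 - fderiv 𝕜 G z.2.1 w.2.1) := by
  have h0 := ((contDiffAt_shear hA hG).differentiableAt (by simp)).hasFDerivAt.snd
  have h1 : HasFDerivAt (fun z : DarbouxSpace 𝕜 (m + 1) => z.2.1) _ z :=
    ((ContinuousLinearMap.fst 𝕜 (Fin (m + 1) → 𝕜) 𝕜).comp
      (ContinuousLinearMap.snd 𝕜 (Fin (m + 1) → 𝕜) _)).hasFDerivAt
  have h2 : HasFDerivAt (fun z : DarbouxSpace 𝕜 (m + 1) => z.2.2) _ z :=
    ((ContinuousLinearMap.snd 𝕜 (Fin (m + 1) → 𝕜) 𝕜).comp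
      (ContinuousLinearMap.snd 𝕜 (Fin (m + 1) → 𝕜) _)).hasFDerivAt
  have h3 := (hA.differentiableAt (by simp)).hasFDerivAt.comp z h1
  have h4 := (hG.differentiableAt (by simp)).hasFDerivAt.comp z h1
  have h5 := (h1.sub (h3.smul_const (Pi.single (Fin.last m) 1 : Fin (m + 1) → 𝕜))).prodMk
    (h2.sub h4)
  exact DFunLike.congr_fun (h0.unique h5) w

/-- Since `A` and `G` do not depend on qₙ, the coordinate pₙ is unchanged. The change of the other
pᵢ contributes pₙ dA - dG to ∑ pᵢ dqᵢ, which offsets the terms coming from the shifts of qₙ and r.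
-/
theorem stdForm_fderiv_shear {A G : (Fin (m + 1) → 𝕜) → 𝕜}
    (hA : ∀ q, A (dropLast 𝕜 m q) = A q) (hG : ∀ q, G (dropLast 𝕜 m q) = G q)
    {z : DarbouxSpace 𝕜 (m + 1)}
    (hAs : ContDiffAt 𝕜 ∞ A z.2.1) (hGs : ContDiffAt 𝕜 ∞ G z.2.1) (w : DarbouxSpace 𝕜 (m + 1)) :
    stdForm 𝕜 (m + 1) (shear A G z) (fderiv 𝕜 (shear A G) z w) = stdForm 𝕜 (m + 1) z w := by
  rw [stdForm_apply, stdForm_apply, fderiv_shear_snd hAs hGs]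
  have h1 := shear_fst_last (z := z) hA hG (hAs.differentiableAt (by simp))
    (hGs.differentiableAt (by simp))
  have h2 : ∀ c : 𝕜, ∑ i, (shear A G z).1 i * (w.2.1 - c • Pi.single (Fin.last m) 1 :
      Fin (m + 1) → 𝕜) i =
      ∑ i, (shear A G z).1 i * w.2.1 i - c * z.1 (Fin.last m) := by
    intro c
    simp [mul_sub, Finset.sum_sub_distrib, Pi.single_apply, h1]
    ring
  have h3 : ∑ i, (shear A G z).1 i * w.2.1 i = ∑ i, z.1 i * w.2.1 i +
      z.1 (Fin.last m) * fderiv 𝕜 A z.2.1 w.2.1 - fderiv 𝕜 G z.2.1 w.2.1 := by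
    rw [fderiv_apply_eq_sum_grad, fderiv_apply_eq_sum_grad, Finset.mul_sum,
      ← Finset.sum_add_distrib, ← Finset.sum_sub_distrib]
    refine Finset.sum_congr rfl fun i _ => ?_
    simp [shear]
    ring
  simp only [h2, h3]
  ring

/-- The differential at the origin is triangular. A vector in its kernel has zero q-part because `A`
is constant in qₙ, then zero r-part; the p-part satisfies dp + dpₙ grad A = 0, whose last entry
gives dpₙ = 0 and so dp = 0. -/
theorem exists_hasFDerivAt_shear {A G : (Fin (m + 1) → 𝕜) → 𝕜}
    (hA : ∀ q, A (dropLast 𝕜 m q) = A q) (hAs : ContDiffAt 𝕜 ∞ A 0) (hGs : ContDiffAt 𝕜 ∞ G 0) :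
    ∃ T : DarbouxSpace 𝕜 (m + 1) ≃L[𝕜] DarbouxSpace 𝕜 (m + 1),
      HasFDerivAt (shear A G) (T : DarbouxSpace 𝕜 (m + 1) →L[𝕜] DarbouxSpace 𝕜 (m + 1)) 0 := by
  have hs : HasFDerivAt (shear A G) (fderiv 𝕜 (shear A G) 0) 0 :=
    ((contDiffAt_shear (z := 0) hAs hGs).differentiableAt (by simp)).hasFDerivAt
  have hAl := grad_last hA (hAs.differentiableAt (by simp))
  obtain ⟨T, hT⟩ := isInvertible_of_injective (fderiv 𝕜 (shear A G) 0) (by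
    rw [injective_iff_map_eq_zero]
    intro w hw
    have h1 := fderiv_shear_snd (z := 0) hAs hGs w
    rw [hw] at h1
    have h2 : w.2.1 = fderiv 𝕜 A 0 w.2.1 • Pi.single (Fin.last m) 1 :=
      (sub_eq_zero.1 (congrArg Prod.fst h1).symm)
    have h3 : w.2.1 = 0 := by
      have h4 : fderiv 𝕜 A 0 w.2.1 = 0 := by
        rw [h2, map_smul]
        have : fderiv 𝕜 A 0 (Pi.single (Fin.last m) 1) = 0 := hAl
        rw [this, smul_zero]
      rw [h2, h4, zero_smul]
    have h5 : w.2.2 = 0 := by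
      have := (sub_eq_zero.1 (congrArg Prod.snd h1).symm)
      rw [this, h3, map_zero]
    have h6 : HasFDerivAt (fun z : DarbouxSpace 𝕜 (m + 1) => z.2.1) _ 0 :=
      ((ContinuousLinearMap.fst 𝕜 (Fin (m + 1) → 𝕜) 𝕜).comp
      (ContinuousLinearMap.snd 𝕜 (Fin (m + 1) → 𝕜) _)).hasFDerivAt
    have h7 := ((contDiffAt_grad hAs).differentiableAt (by simp)).hasFDerivAt.comp
      (0 : DarbouxSpace 𝕜 (m + 1)) h6
    have h8 := ((contDiffAt_grad hGs).differentiableAt (by simp)).hasFDerivAt.comp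
      (0 : DarbouxSpace 𝕜 (m + 1)) h6
    have h9 : HasFDerivAt (fun z : DarbouxSpace 𝕜 (m + 1) => z.1) _ 0 :=
      (ContinuousLinearMap.fst 𝕜 (Fin (m + 1) → 𝕜) ((Fin (m + 1) → 𝕜) × 𝕜)).hasFDerivAt
    have h10 := (h9.add ((hasFDerivAt_pi'.1 h9 (Fin.last m)).smul h7)).sub h8
    have h11 := DFunLike.congr_fun (hs.fst.unique h10) w
    have h12 : (0 : Fin (m + 1) → 𝕜) = w.1 + w.1 (Fin.last m) • grad A 0 := by
      simpa [h3, hw] using h11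
    have h13 : w.1 (Fin.last m) = 0 := by
      have := congrFun h12 (Fin.last m)
      simpa [hAl] using this.symm
    rw [h13, zero_smul, add_zero] at h12
    exact Prod.ext h12.symm (Prod.ext h3 h5)) rfl
  exact ⟨T, hT ▸ hs⟩

/-- A contact transformation which makes `qₙ` and `r` vanish along an integral map-germ where
`xₙ = 0`. -/
theorem exists_contact_transformation {k : (Fin (m + 1) → 𝕜) → DarbouxSpace 𝕜 (m + 1)}
    (hk : ∀ᶠ x in 𝓝 0, ContDiffAt 𝕜 ∞ k x) (hk0 : k 0 = 0)
    (hint : ∀ᶠ x in 𝓝 0, ∀ v, stdForm 𝕜 (m + 1) (k x) (fderiv 𝕜 k x v) = 0)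
    (hq : ∀ᶠ x in 𝓝 0, ∀ i : Fin m, (k x).2.1 i.castSucc = x i.castSucc) :
    ∃ (τ : DarbouxSpace 𝕜 (m + 1) → DarbouxSpace 𝕜 (m + 1))
      (T : DarbouxSpace 𝕜 (m + 1) ≃L[𝕜] DarbouxSpace 𝕜 (m + 1)),
      (∀ᶠ z in 𝓝 0, ContDiffAt 𝕜 ∞ τ z) ∧ τ 0 = 0 ∧
      HasFDerivAt τ (T : DarbouxSpace 𝕜 (m + 1) →L[𝕜] DarbouxSpace 𝕜 (m + 1)) 0 ∧
      (∀ᶠ z in 𝓝 0, ∀ w, stdForm 𝕜 (m + 1) (τ z) (fderiv 𝕜 τ z w) = stdForm 𝕜 (m + 1) z w) ∧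
      (∀ᶠ x in 𝓝 0, ∀ i : Fin m, (τ (k x)).2.1 i.castSucc = x i.castSucc) ∧
      (∀ᶠ x in 𝓝 0, (τ (k (dropLast 𝕜 m x))).2.1 (Fin.last m) = 0) ∧
      ∀ᶠ x in 𝓝 0, (τ (k (dropLast 𝕜 m x))).2.2 = 0 := by
  have hdd : ∀ q, dropLast 𝕜 m (dropLast 𝕜 m q) = dropLast 𝕜 m q := fun q => by
    simp [dropLast_apply]
  -- Along xₙ = 0 the first q-coordinates parametrise the image, so qₙ and r are there functions of
  -- them; these functions are to be subtracted.
  set A : (Fin (m + 1) → 𝕜) → 𝕜 := fun q => (k (dropLast 𝕜 m q)).2.1 (Fin.last m) with hA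
  set G : (Fin (m + 1) → 𝕜) → 𝕜 := fun q => (k (dropLast 𝕜 m q)).2.2 with hG
  have hAd : ∀ q, A (dropLast 𝕜 m q) = A q := fun q => by simp only [hA, hdd]
  have hGd : ∀ q, G (dropLast 𝕜 m q) = G q := fun q => by simp only [hG, hdd]
  have hdrop : Tendsto (dropLast 𝕜 m) (𝓝 0) (𝓝 0) := by
    have := (dropLast 𝕜 m).continuous.tendsto 0
    rwa [map_zero] at this
  have hkd : ∀ᶠ q in 𝓝 0, ContDiffAt 𝕜 ∞ (fun q => k (dropLast 𝕜 m q)) q := by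
    filter_upwards [hdrop.eventually hk] with q h
    exact h.comp q (dropLast 𝕜 m).contDiff.contDiffAt
  have hAs : ∀ᶠ q in 𝓝 0, ContDiffAt 𝕜 ∞ A q := by
    filter_upwards [hkd] with q h using contDiffAt_pi.1 h.snd.fst _
  have hGs : ∀ᶠ q in 𝓝 0, ContDiffAt 𝕜 ∞ G q := by
    filter_upwards [hkd] with q h using h.snd.snd
  have hA0 : A 0 = 0 := by simp [hA, hk0]
  have hG0 : G 0 = 0 := by simp [hG, hk0]
  -- Integrality at the origin, where p = 0, gives dr = 0. This is what makes the shear fix the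
  -- origin.
  have hgradG : grad G 0 = 0 := by
    ext i
    have h1 : DifferentiableAt 𝕜 k (dropLast 𝕜 m 0) := by
      rw [map_zero]; exact hk.self_of_nhds.differentiableAt (by simp)
    have h2 : HasFDerivAt (fun q => k (dropLast 𝕜 m q)) _ 0 :=
      h1.hasFDerivAt.comp (0 : Fin (m + 1) → 𝕜) (dropLast 𝕜 m).hasFDerivAt
    have h3 := hint.self_of_nhds (dropLast 𝕜 m (Pi.single i 1))
    rw [stdForm_apply, hk0] at h3
    rw [grad, partialDeriv, h2.snd.snd.fderiv]
    simpa using h3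
  have hp : Tendsto (fun z : DarbouxSpace 𝕜 (m + 1) => z.2.1) (𝓝 0) (𝓝 0) :=
    (continuous_fst.comp continuous_snd).tendsto 0
  obtain ⟨T, hT⟩ := exists_hasFDerivAt_shear hAd hAs.self_of_nhds hGs.self_of_nhds
  refine ⟨shear A G, T, ?_, ?_, hT, ?_, ?_, ?_, ?_⟩
  · filter_upwards [hp.eventually hAs, hp.eventually hGs] with z h1 h2 using contDiffAt_shear h1 h2
  · simp [shear, hA0, hG0, hgradG]
  · filter_upwards [hp.eventually hAs, hp.eventually hGs] with z h1 h2 w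
    exact stdForm_fderiv_shear hAd hGd h1 h2 w
  · filter_upwards [hq] with x hx i
    simp [shear, hx, Fin.castSucc_ne_last]
  all_goals
    filter_upwards [hdrop.eventually hq] with x hx
    have h1 : dropLast 𝕜 m (k (dropLast 𝕜 m x)).2.1 = dropLast 𝕜 m x := by
      ext i
      refine Fin.lastCases ?_ (fun i => ?_) i
      · simp [dropLast_apply]
      · have := hx i
        simpa [dropLast_apply, Fin.castSucc_ne_last] using this
    simp [shear, hA, hG, h1]

end Shear

/-! ### Integral map-germs between vector spaces -/

section IntegralGerms

variable {𝕜 : Type*} [RCLike 𝕜]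
  {E : Type*} [NormedAddCommGroup E] [NormedSpace 𝕜 E]
  {F : Type*} [NormedAddCommGroup F] [NormedSpace 𝕜 F]
  {G : Type*} [NormedAddCommGroup G] [NormedSpace 𝕜 G]

/-- The map-germ `h` between vector spaces is smooth, and integral for the field of kernels
of `a`. -/
def IsIntegralMapGerm (a : F → F →L[𝕜] 𝕜) (h : E → F) (y₀ : E) : Prop :=
  ∀ᶠ y in 𝓝 y₀, ContDiffAt 𝕜 ∞ h y ∧ ∀ v, a (h y) (fderiv 𝕜 h y v) = 0

/-- The map-germ `τ` between vector spaces is smooth, and maps kernels of `a` to kernels of `b`. -/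
def IsKerMapGerm (a : F → F →L[𝕜] 𝕜) (b : G → G →L[𝕜] 𝕜) (τ : F → G) (z₀ : F) : Prop :=
  ∀ᶠ z in 𝓝 z₀, ContDiffAt 𝕜 ∞ τ z ∧ ∀ w, a z w = 0 → b (τ z) (fderiv 𝕜 τ z w) = 0

theorem fderiv_comp_apply {h : E → F} {τ : F → G} {y : E} (hh : ContDiffAt 𝕜 ∞ h y)
    (hτ : ContDiffAt 𝕜 ∞ τ (h y)) (v : E) :
    fderiv 𝕜 (τ ∘ h) y v = fderiv 𝕜 τ (h y) (fderiv 𝕜 h y v) := by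
  rw [fderiv_comp y (hτ.differentiableAt (by simp)) (hh.differentiableAt (by simp))]
  rfl

theorem IsKerMapGerm.comp_integral {a : F → F →L[𝕜] 𝕜} {b : G → G →L[𝕜] 𝕜} {τ : F → G} {h : E → F}
    {y₀ : E} (hτ : IsKerMapGerm a b τ (h y₀)) (hh : IsIntegralMapGerm a h y₀) :
    IsIntegralMapGerm b (τ ∘ h) y₀ := by
  filter_upwards [hh, hh.self_of_nhds.1.continuousAt.eventually hτ] with y h1 h2
  refine ⟨h2.1.comp y h1.1, fun v => ?_⟩
  rw [fderiv_comp_apply h1.1 h2.1]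
  exact h2.2 _ (h1.2 v)

theorem IsKerMapGerm.comp {a : F → F →L[𝕜] 𝕜} {b : G → G →L[𝕜] 𝕜} {c : E → E →L[𝕜] 𝕜}
    {τ : F → G} {h : E → F} {y₀ : E} (hτ : IsKerMapGerm a b τ (h y₀)) (hh : IsKerMapGerm c a h y₀) :
    IsKerMapGerm c b (τ ∘ h) y₀ := by
  filter_upwards [hh, hh.self_of_nhds.1.continuousAt.eventually hτ] with y h1 h2
  refine ⟨h2.1.comp y h1.1, fun v hv => ?_⟩
  rw [fderiv_comp_apply h1.1 h2.1]
  exact h2.2 _ (h1.2 v hv)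

theorem IsIntegralMapGerm.comp_right {b : G → G →L[𝕜] 𝕜} {h : F → G} {g : E → F}
    {x₀ : E} (hh : IsIntegralMapGerm b h (g x₀)) (hg : ∀ᶠ x in 𝓝 x₀, ContDiffAt 𝕜 ∞ g x) :
    IsIntegralMapGerm b (h ∘ g) x₀ := by
  filter_upwards [hg, hg.self_of_nhds.continuousAt.eventually hh] with x h1 h2
  refine ⟨h2.1.comp x h1, fun v => ?_⟩
  rw [fderiv_comp_apply h1 h2.1]
  exact h2.2 _

theorem IsIntegralMapGerm.congr {b : F → F →L[𝕜] 𝕜} {h h' : E → F} {x₀ : E}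
    (hh : IsIntegralMapGerm b h x₀) (he : h =ᶠ[𝓝 x₀] h') : IsIntegralMapGerm b h' x₀ := by
  filter_upwards [hh, he.eventuallyEq_nhds] with x h1 h2
  refine ⟨h1.1.congr_of_eventuallyEq h2.symm, fun v => ?_⟩
  rw [← h2.self_of_nhds, ← h2.fderiv_eq]
  exact h1.2 v

/-- The differential of an integral map-germ has isotropic image. -/
theorem IsIntegralMapGerm.dForm_eq_zero {a : F → F →L[𝕜] 𝕜} {h : E → F} {y₀ : E}
    (hh : IsIntegralMapGerm a h y₀) (ha : ContDiffAt 𝕜 ∞ a (h y₀)) (v w : E) :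
    dForm a (h y₀) (fderiv 𝕜 h y₀ v) (fderiv 𝕜 h y₀ w) = 0 := by
  have hs := hh.self_of_nhds.1
  have hd := (hs.differentiableAt (by simp)).hasFDerivAt
  have had := (ha.differentiableAt (by simp)).hasFDerivAt
  have hd' := (((hs.fderiv_right (m := ∞) (by simp)).differentiableAt (by simp))).hasFDerivAt
  have hsymm : IsSymmSndFDerivAt 𝕜 h y₀ := hs.isSymmSndFDerivAt
    (by rw [minSmoothness_of_isRCLikeNormedField]; exact ENat.LEInfty.out)
  -- The derivative in the direction `v` of `a (h y) (dh w) = 0`. The second derivative of `h` is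
  -- symmetric and drops out on exchanging `v` and `w`.
  have key : ∀ v w, a (h y₀) (fderiv 𝕜 (fderiv 𝕜 h) y₀ v w) +
      fderiv 𝕜 a (h y₀) (fderiv 𝕜 h y₀ v) (fderiv 𝕜 h y₀ w) = 0 := by
    intro v w
    have h1 := (had.comp y₀ hd).clm_apply (hd'.clm_apply (hasFDerivAt_const w y₀))
    have h2 : HasFDerivAt (fun y => a (h y) (fderiv 𝕜 h y w)) (0 : E →L[𝕜] 𝕜) y₀ :=
      (hasFDerivAt_const (0 : 𝕜) y₀).congr_of_eventuallyEq
        (by filter_upwards [hh] with y hy using hy.2 w)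
    have h3 := DFunLike.congr_fun (h1.unique h2) v
    simpa using h3
  have h1 := key v w
  have h2 := key w v
  rw [hsymm.eq] at h2
  rw [dForm]
  linear_combination h1 - h2

end IntegralGerms

/-! ### Source coordinates and the normal form in vector spaces -/

section SourceCoordinates

variable {𝕜 : Type*} [RCLike 𝕜] {m : ℕ}
  {E : Type*} [NormedAddCommGroup E] [NormedSpace 𝕜 E] [FiniteDimensional 𝕜 E]

/-- `m` linear forms which are dual to some family of vectors can be completed to a system of
linear coordinates. -/
theorem exists_completion (hE : Module.finrank 𝕜 E = m + 1) (l : Fin m → E →L[𝕜] 𝕜) {ε : Fin m → E}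
    (hl : ∀ i j, l j (ε i) = (Pi.single i 1 : Fin m → 𝕜) j) :
    ∃ c : E →L[𝕜] 𝕜, ∀ v, (∀ i, l i v = 0) → c v = 0 → v = 0 := by
  set ρ : E →ₗ[𝕜] Fin m → 𝕜 := LinearMap.pi fun i => (l i).toLinearMap with hρ
  have hsurj : LinearMap.range ρ = ⊤ := by
    rw [LinearMap.range_eq_top]
    intro y
    refine ⟨∑ i, y i • ε i, funext fun j => ?_⟩
    simp [hρ, hl, Pi.single_apply]
  have h1 := ρ.finrank_range_add_finrank_ker
  rw [hsurj, finrank_top, Module.finrank_fin_fun, hE] at h1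
  -- The common kernel of the `m` forms is a line, and any form which is nonzero on it completes the
  -- system.
  obtain ⟨κ, hκ, hκ'⟩ := finrank_eq_one_iff'.1 (show Module.finrank 𝕜 (LinearMap.ker ρ) = 1 by omega)
  obtain ⟨c, hc⟩ := SeparatingDual.exists_eq_one (R := 𝕜) (x := (κ : E))
    (fun h => hκ (Subtype.ext h))
  refine ⟨c, fun v hv hcv => ?_⟩
  obtain ⟨s, hs⟩ := hκ' ⟨v, LinearMap.mem_ker.2 (funext hv)⟩
  have hs' : s • (κ : E) = v := congrArg Subtype.val hs
  rw [← hs', map_smul, hc, smul_eq_mul, mul_one] at hcv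
  rw [← hs', hcv, zero_smul]

/-- Coordinates on the source of a map-germ of corank at most one. -/
theorem exists_source_coordinates (hE : Module.finrank 𝕜 E = m + 1)
    {h : E → DarbouxSpace 𝕜 (m + 1)} {y₀ : E} (hh : ∀ᶠ y in 𝓝 y₀, ContDiffAt 𝕜 ∞ h y)
    (h0 : h y₀ = 0) {ε : Fin m → E}
    (hε : ∀ i j, (fderiv 𝕜 h y₀ (ε i)).2.1 j = (Pi.single i.castSucc 1 : Fin (m + 1) → 𝕜) j) :
    ∃ (σ : E → Fin (m + 1) → 𝕜) (S : E ≃L[𝕜] (Fin (m + 1) → 𝕜)),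
      (∀ᶠ y in 𝓝 y₀, ContDiffAt 𝕜 ∞ σ y) ∧ σ y₀ = 0 ∧
      HasFDerivAt σ (S : E →L[𝕜] (Fin (m + 1) → 𝕜)) y₀ ∧
      ∀ y, ∀ i : Fin m, σ y i.castSucc = (h y).2.1 i.castSucc := by
  have hd := (hh.self_of_nhds.differentiableAt (by simp)).hasFDerivAt
  set l : Fin m → E →L[𝕜] 𝕜 := fun i => fderiv 𝕜 (fun y => (h y).2.1 i.castSucc) y₀ with hl
  have hld : ∀ i, HasFDerivAt (fun y => (h y).2.1 i.castSucc) (l i) y₀ := fun i =>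
    ((hasFDerivAt_pi'.1 hd.snd.fst) i.castSucc).differentiableAt.hasFDerivAt
  have hlv : ∀ i v, l i v = (fderiv 𝕜 h y₀ v).2.1 i.castSucc := fun i v => by
    rw [(hld i).unique ((hasFDerivAt_pi'.1 hd.snd.fst) i.castSucc)]; rfl
  obtain ⟨c, hc⟩ := exists_completion hE l (ε := ε) (fun i j => by
    rw [hlv, hε]; simp [Pi.single_apply])
  set σ : E → Fin (m + 1) → 𝕜 := fun y =>
    Fin.snoc (α := fun _ => 𝕜) (fun i : Fin m => (h y).2.1 i.castSucc) (c (y - y₀)) with hσ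
  set S₀ : E →L[𝕜] (Fin (m + 1) → 𝕜) :=
    ContinuousLinearMap.pi (Fin.snoc (α := fun _ => E →L[𝕜] 𝕜) l c) with hS₀
  have hcd : HasFDerivAt (fun y => c (y - y₀)) c y₀ :=
    HasFDerivAt.comp (f := fun y => y - y₀) y₀ c.hasFDerivAt ((hasFDerivAt_id y₀).sub_const y₀)
  have hσd : HasFDerivAt σ S₀ y₀ := by
    rw [hasFDerivAt_pi']
    intro i
    refine Fin.lastCases ?_ (fun i => ?_) i
    · simp only [hσ, Fin.snoc_last]
      refine hcd.congr_fderiv ?_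
      ext v
      simp [hS₀]
    · simp only [hσ, Fin.snoc_castSucc]
      refine (hld i).congr_fderiv ?_
      ext v
      simp [hS₀]
  obtain ⟨S, hS⟩ := isInvertible_of_injective S₀ (by
    rw [injective_iff_map_eq_zero]
    intro v hv
    refine hc v (fun i => ?_) ?_
    · simpa [hS₀] using congrFun hv i.castSucc
    · simpa [hS₀] using congrFun hv (Fin.last m)) (by simpa using hE)
  refine ⟨σ, S, ?_, ?_, hS ▸ hσd, fun y i => by simp [hσ]⟩
  · filter_upwards [hh] with y hy
    refine contDiffAt_pi.2 fun i => ?_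
    refine Fin.lastCases ?_ (fun i => ?_) i
    · simp only [hσ, Fin.snoc_last]
      exact c.contDiff.contDiffAt.comp y (contDiffAt_id.sub contDiffAt_const)
    · simp only [hσ, Fin.snoc_castSucc]
      exact contDiffAt_pi.1 hy.snd.fst _
  · ext i
    refine Fin.lastCases ?_ (fun i => ?_) i <;> simp [hσ, h0]

/-- The normal form of integral map-germs of corank at most one between vector spaces. -/
theorem exists_preNormal {F : Type*} [NormedAddCommGroup F] [NormedSpace 𝕜 F]
    [FiniteDimensional 𝕜 F] (hE : Module.finrank 𝕜 E = m + 1)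
    (hF : Module.finrank 𝕜 F = 2 * (m + 1) + 1) {a : F → F →L[𝕜] 𝕜} {h : E → F} {y₀ : E}
    (ha : ∀ᶠ z in 𝓝 (h y₀), ContDiffAt 𝕜 ∞ a z) (hc : IsContactFormAt a (h y₀))
    (hh : IsIntegralMapGerm a h y₀)
    (hker : Module.finrank 𝕜 (LinearMap.ker (fderiv 𝕜 h y₀).toLinearMap) ≤ 1) :
    ∃ u v : (Fin (m + 1) → 𝕜) → 𝕜,
      (∀ᶠ x in 𝓝 0, ContDiffAt 𝕜 ∞ u x) ∧ u 0 = 0 ∧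
      (∀ᶠ x in 𝓝 0, ContDiffAt 𝕜 ∞ v x) ∧ v 0 = 0 ∧
      preNormal u v 0 = 0 ∧ IsIntegralMapGerm (stdForm 𝕜 (m + 1)) (preNormal u v) 0 ∧
      ∃ (σ : E → Fin (m + 1) → 𝕜) (S : E ≃L[𝕜] (Fin (m + 1) → 𝕜))
        (τ : F → DarbouxSpace 𝕜 (m + 1)) (T : F ≃L[𝕜] DarbouxSpace 𝕜 (m + 1)),
        (∀ᶠ y in 𝓝 y₀, ContDiffAt 𝕜 ∞ σ y) ∧ σ y₀ = 0 ∧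
        HasFDerivAt σ (S : E →L[𝕜] (Fin (m + 1) → 𝕜)) y₀ ∧ τ (h y₀) = 0 ∧
        HasFDerivAt τ (T : F →L[𝕜] DarbouxSpace 𝕜 (m + 1)) (h y₀) ∧
        IsKerMapGerm a (stdForm 𝕜 (m + 1)) τ (h y₀) ∧
        preNormal u v ∘ σ =ᶠ[𝓝 y₀] τ ∘ h := by
  have : CompleteSpace E := FiniteDimensional.complete 𝕜 E
  have hrank : m ≤ Module.finrank 𝕜 (LinearMap.range (fderiv 𝕜 h y₀).toLinearMap) := by
    have := (fderiv 𝕜 h y₀).toLinearMap.finrank_range_add_finrank_ker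
    omega
  obtain ⟨e, he⟩ := exists_linearIndependent_of_le_finrank hrank
  have he' : LinearIndependent 𝕜 (fun i => (e i : F)) :=
    he.map' _ (Submodule.ker_subtype _)
  have hε : ∀ i, ∃ ε, fderiv 𝕜 h y₀ ε = e i := fun i => (e i).2
  choose ε hε using hε
  obtain ⟨τ₁, T₁, hτ₁s, hτ₁0, hτ₁d, hT₁, hτ₁⟩ := exists_darboux_germ hF ha hc he'
    (fun i => by rw [← hε]; exact hh.self_of_nhds.2 _)
    (fun i j => by rw [← hε, ← hε]; exact hh.dForm_eq_zero ha.self_of_nhds _ _)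
  have hτ₁k : IsKerMapGerm a (stdForm 𝕜 (m + 1)) τ₁ (h y₀) := hτ₁s.and hτ₁
  have hh₁ : IsIntegralMapGerm (stdForm 𝕜 (m + 1)) (τ₁ ∘ h) y₀ := hτ₁k.comp_integral hh
  obtain ⟨σ, S, hσs, hσ0, hσd, hσ⟩ := exists_source_coordinates hE (hh₁.mono fun _ hy => hy.1)
    (show (τ₁ ∘ h) y₀ = 0 from hτ₁0) (ε := ε) (fun i j => by
      rw [fderiv_comp_apply hh.self_of_nhds.1 hτ₁s.self_of_nhds, hτ₁d.fderiv, hε]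
      exact hT₁ i j)
  obtain ⟨g, hgσ, hgy₀, -, hgs⟩ := exists_openPartialHomeomorph hσs hσd
  have h0t : (0 : Fin (m + 1) → 𝕜) ∈ g.target := by
    have := g.map_source hgy₀
    rwa [hgσ, hσ0] at this
  have hg0 : g.symm 0 = y₀ := by
    have := g.left_inv hgy₀
    rwa [hgσ, hσ0] at this
  have hgs' : ∀ᶠ x in 𝓝 0, ContDiffAt 𝕜 ∞ g.symm x := by
    filter_upwards [g.open_target.mem_nhds h0t] with x hx using hgs x hx
  set k : (Fin (m + 1) → 𝕜) → DarbouxSpace 𝕜 (m + 1) := (τ₁ ∘ h) ∘ g.symm with hk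
  have hk0 : k 0 = 0 := by simp [hk, hg0, hτ₁0]
  have hki : IsIntegralMapGerm (stdForm 𝕜 (m + 1)) k 0 :=
    IsIntegralMapGerm.comp_right (by rwa [hg0]) hgs'
  have hkq : ∀ᶠ x in 𝓝 0, ∀ i : Fin m, (k x).2.1 i.castSucc = x i.castSucc := by
    filter_upwards [g.open_target.mem_nhds h0t] with x hx i
    have h1 := hσ (g.symm x) i
    rw [← hgσ, g.right_inv hx] at h1
    exact h1.symm
  obtain ⟨τ₂, T₂, hτ₂s, hτ₂0, hτ₂d, hτ₂, hq, hq0, hr0⟩ := exists_contact_transformation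
    (hki.mono fun _ hx => hx.1) hk0 (hki.mono fun _ hx => hx.2) hkq
  have hτ₂k : IsKerMapGerm (stdForm 𝕜 (m + 1)) (stdForm 𝕜 (m + 1)) τ₂ 0 :=
    (hτ₂s.and hτ₂).mono fun z hz => ⟨hz.1, fun w hw => by rw [hz.2, hw]⟩
  have hki' : IsIntegralMapGerm (stdForm 𝕜 (m + 1)) (τ₂ ∘ k) 0 :=
    IsKerMapGerm.comp_integral (by rwa [hk0]) hki
  have hpre := eventuallyEq_preNormal (hki'.mono fun _ hx => hx.1) (hki'.mono fun _ hx => hx.2)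
    hq hq0 hr0
  have hk'0 : (τ₂ ∘ k) 0 = 0 := by simp [hk0, hτ₂0]
  -- The functions `u` and `v` are qₙ and pₙ of `τ₂ ∘ k`, found by unification with `hpre`.
  refine ⟨_, _, ?_, ?_, ?_, ?_, hpre.self_of_nhds.symm.trans hk'0, hki'.congr hpre, σ, S, τ₂ ∘ τ₁,
    T₁.trans T₂, hσs, hσ0, hσd, by simp [hτ₁0, hτ₂0], ?_, ?_, ?_⟩
  · filter_upwards [hki'] with x hx using contDiffAt_pi.1 hx.1.snd.fst _
  · simp [hk0, hτ₂0]
  · filter_upwards [hki'] with x hx using contDiffAt_pi.1 hx.1.fst _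
  · simp [hk0, hτ₂0]
  · exact HasFDerivAt.comp (h y₀) (by rwa [hτ₁0]) hτ₁d
  · exact IsKerMapGerm.comp (by rwa [hτ₁0]) hτ₁k
  · have h1 : Tendsto σ (𝓝 y₀) (𝓝 0) := by
      have := hσs.self_of_nhds.continuousAt.tendsto
      rwa [hσ0] at this
    filter_upwards [h1.eventually hpre, g.open_source.mem_nhds hgy₀] with y hy hy'
    rw [Function.comp_apply, ← hy]
    simp only [hk, Function.comp_apply]
    rw [← hgσ, g.left_inv hy']

end SourceCoordinates

/-! ### Passage between manifolds and charts -/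

section Charts

variable {𝕜 : Type*} [RCLike 𝕜]
  {E : Type*} [NormedAddCommGroup E] [NormedSpace 𝕜 E]
  {N : Type*} [TopologicalSpace N] [ChartedSpace E N]
  {F : Type*} [NormedAddCommGroup F] [NormedSpace 𝕜 F]
  {W : Type*} [TopologicalSpace W] [ChartedSpace F W]

theorem isLocalDiffeomorphAt_extChartAt [IsManifold 𝓘(𝕜, E) ∞ N] (x₀ : N) :
    IsLocalDiffeomorphAt 𝓘(𝕜, E) 𝓘(𝕜, E) ∞ (extChartAt 𝓘(𝕜, E) x₀) x₀ := by
  refine ⟨⟨(chartAt E x₀).toPartialEquiv, (chartAt E x₀).open_source, (chartAt E x₀).open_target,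
    contMDiffOn_chart, contMDiffOn_chart_symm⟩, mem_chart_source E x₀, fun x _ => ?_⟩
  simp

/-- A smooth map-germ with invertible differential, read in a chart, is a
local diffeomorphism. -/
theorem isLocalDiffeomorphAt_comp_extChartAt [IsManifold 𝓘(𝕜, E) ∞ N] [CompleteSpace E]
    {V : Type*} [NormedAddCommGroup V]
    [NormedSpace 𝕜 V] {x₀ : N} {σ : E → V} {S : E ≃L[𝕜] V}
    (hσ : ∀ᶠ y in 𝓝 (extChartAt 𝓘(𝕜, E) x₀ x₀), ContDiffAt 𝕜 ∞ σ y)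
    (hS : HasFDerivAt σ (S : E →L[𝕜] V) (extChartAt 𝓘(𝕜, E) x₀ x₀)) :
    IsLocalDiffeomorphAt 𝓘(𝕜, E) 𝓘(𝕜, V) ∞ (σ ∘ extChartAt 𝓘(𝕜, E) x₀) x₀ := by
  obtain ⟨g, hg, hx, hgs, hgs'⟩ := exists_openPartialHomeomorph hσ hS
  let Φ : PartialDiffeomorph 𝓘(𝕜, E) 𝓘(𝕜, V) E V ∞ :=
    { toPartialEquiv := g.toPartialEquiv
      open_source := g.open_source
      open_target := g.open_target
      contMDiffOn_toFun := fun y hy => by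
        refine ContMDiffAt.contMDiffWithinAt (contMDiffAt_iff_contDiffAt.2 ?_)
        exact (hgs y hy).congr_of_eventuallyEq (Eventually.of_forall hg)
      contMDiffOn_invFun := fun y hy =>
        ContMDiffAt.contMDiffWithinAt (contMDiffAt_iff_contDiffAt.2 (hgs' y hy)) }
  exact (isLocalDiffeomorphAt_extChartAt x₀).comp (K := 𝓘(𝕜, V)) (P := V)
    (hg := ⟨Φ, hx, fun y _ => (hg y).symm⟩)

/-- Transfers the corank hypothesis to the chart expression: at the base point of the preferred
charts no change of coordinates intervenes. -/
theorem fderiv_writtenInExtChartAt {f : N → W} {x₀ : N}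
    (hf : ContMDiffAt 𝓘(𝕜, E) 𝓘(𝕜, F) ∞ f x₀) :
    fderiv 𝕜 (writtenInExtChartAt 𝓘(𝕜, E) 𝓘(𝕜, F) x₀ f) (extChartAt 𝓘(𝕜, E) x₀ x₀) =
      mfderiv 𝓘(𝕜, E) 𝓘(𝕜, F) f x₀ := by
  rw [(hf.mdifferentiableAt (by simp)).mfderiv]
  simp

/-- An integral map-germ between manifolds is integral when read in charts. -/
theorem IsIntegralGerm.isIntegralMapGerm [IsManifold 𝓘(𝕜, E) ∞ N] [IsManifold 𝓘(𝕜, F) ∞ W]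
    {D : ∀ w : W, Submodule 𝕜 (TangentSpace 𝓘(𝕜, F) w)}
    {f : N → W} {x₀ : N} (hf : IsIntegralGerm (E := E) D f x₀) {α : F → F →L[𝕜] 𝕜}
    (hα : ∀ᶠ w in 𝓝 (f x₀), ∀ v : TangentSpace 𝓘(𝕜, F) w, v ∈ D w ↔
      α (extChartAt 𝓘(𝕜, F) (f x₀) w)
        (mfderiv 𝓘(𝕜, F) 𝓘(𝕜, F) (extChartAt 𝓘(𝕜, F) (f x₀)) w v) = 0) :
    IsIntegralMapGerm α (writtenInExtChartAt 𝓘(𝕜, E) 𝓘(𝕜, F) x₀ f)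
      (extChartAt 𝓘(𝕜, E) x₀ x₀) := by
  have hfc : ContinuousAt f x₀ := hf.self_of_nhds.1.continuousAt
  have hs : Tendsto (extChartAt 𝓘(𝕜, E) x₀).symm (𝓝 (extChartAt 𝓘(𝕜, E) x₀ x₀)) (𝓝 x₀) := by
    have := (continuousAt_extChartAt_symm (I := 𝓘(𝕜, E)) x₀).tendsto
    rwa [extChartAt_to_inv] at this
  filter_upwards [hs.eventually hf, hs.eventually (hfc.eventually hα),
    hs.eventually (hfc.eventually ((chartAt F (f x₀)).open_source.mem_nhds
      (mem_chart_source F (f x₀)))), extChartAt_target_mem_nhds (I := 𝓘(𝕜, E)) x₀]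
    with y h1 h2 h3 h4
  have hsymm : ContMDiffAt 𝓘(𝕜, E) 𝓘(𝕜, E) ∞ (extChartAt 𝓘(𝕜, E) x₀).symm y :=
    (contMDiffOn_extChartAt_symm x₀).contMDiffAt
      ((isOpen_extChartAt_target (I := 𝓘(𝕜, E)) x₀).mem_nhds h4)
  have hchart : ContMDiffAt 𝓘(𝕜, F) 𝓘(𝕜, F) ∞ (extChartAt 𝓘(𝕜, F) (f x₀))
      (f ((extChartAt 𝓘(𝕜, E) x₀).symm y)) := contMDiffAt_extChartAt' h3
  have hcomp : ContMDiffAt 𝓘(𝕜, E) 𝓘(𝕜, F) ∞ (f ∘ (extChartAt 𝓘(𝕜, E) x₀).symm) y :=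
    h1.1.comp y hsymm
  refine ⟨contMDiffAt_iff_contDiffAt.1 (hchart.comp y hcomp), fun v => ?_⟩
  rw [← mfderiv_eq_fderiv]
  have h5 : mfderiv 𝓘(𝕜, E) 𝓘(𝕜, F) (writtenInExtChartAt 𝓘(𝕜, E) 𝓘(𝕜, F) x₀ f) y v =
      mfderiv 𝓘(𝕜, F) 𝓘(𝕜, F) (extChartAt 𝓘(𝕜, F) (f x₀))
        (f ((extChartAt 𝓘(𝕜, E) x₀).symm y))
        (mfderiv 𝓘(𝕜, E) 𝓘(𝕜, F) f ((extChartAt 𝓘(𝕜, E) x₀).symm y)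
          (mfderiv 𝓘(𝕜, E) 𝓘(𝕜, E) (extChartAt 𝓘(𝕜, E) x₀).symm y v)) := by
    have h6 := mfderiv_comp_apply y (hchart.mdifferentiableAt (by simp))
      (hcomp.mdifferentiableAt (by simp)) v
    rw [mfderiv_comp_apply y (h1.1.mdifferentiableAt (by simp))
      (hsymm.mdifferentiableAt (by simp)) v] at h6
    exact h6
  exact (congrArg _ h5).trans ((h2 _).1 (h1.2 _))

theorem IsIntegralMapGerm.isIntegralGerm {n : ℕ} {h : E → DarbouxSpace 𝕜 n} {y₀ : E}
    (hh : IsIntegralMapGerm (stdForm 𝕜 n) h y₀) :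
    IsIntegralGerm (E := E) (stdContact 𝕜 n) h y₀ := by
  filter_upwards [hh] with y hy
  refine ⟨contMDiffAt_iff_contDiffAt.2 hy.1, fun v => ?_⟩
  rw [mfderiv_eq_fderiv]
  exact LinearMap.mem_ker.2 (hy.2 v)

/-- A vector `w` with `a w ≠ 0` spans `F` together with the kernel of `a`; if `b (L w) = 0` as well,
then `b ∘ L = 0`, contradicting `b ≠ 0`. Thus an inclusion of hyperplanes is an equality. -/
theorem apply_eq_zero_of_ker_le {V : Type*} [NormedAddCommGroup V] [NormedSpace 𝕜 V]
    {a : F →L[𝕜] 𝕜} {b : V →L[𝕜] 𝕜} {L : F →L[𝕜] V} (hL : Function.Surjective L) (hb : b ≠ 0)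
    (h : ∀ w, a w = 0 → b (L w) = 0) {w : F} (hw : b (L w) = 0) : a w = 0 := by
  by_contra haw
  refine hb (ContinuousLinearMap.ext fun y => ?_)
  obtain ⟨v, rfl⟩ := hL y
  have h1 := h (v - (a v / a w) • w) (by simp [haw])
  simpa [hw] using h1

theorem stdForm_ne_zero (n : ℕ) (z : DarbouxSpace 𝕜 n) : stdForm 𝕜 n z ≠ 0 := by
  intro h
  have := DFunLike.congr_fun h ((0, 0, 1) : DarbouxSpace 𝕜 n)
  rw [stdForm_apply] at this
  simp at this

/-- A map-germ of the chart domain which maps kernels to kernels induces a map-germ of the manifold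
which preserves the contact structures. -/
theorem eventually_map_eq_stdContact [IsManifold 𝓘(𝕜, F) ∞ W] [CompleteSpace F] {n : ℕ}
    {D : ∀ w : W, Submodule 𝕜 (TangentSpace 𝓘(𝕜, F) w)} {w₀ : W} {α : F → F →L[𝕜] 𝕜}
    (hα : ∀ᶠ w in 𝓝 w₀, ∀ v : TangentSpace 𝓘(𝕜, F) w, v ∈ D w ↔
      α (extChartAt 𝓘(𝕜, F) w₀ w)
        (mfderiv 𝓘(𝕜, F) 𝓘(𝕜, F) (extChartAt 𝓘(𝕜, F) w₀) w v) = 0)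
    {τ : F → DarbouxSpace 𝕜 n} {T : F ≃L[𝕜] DarbouxSpace 𝕜 n}
    (hτ : IsKerMapGerm α (stdForm 𝕜 n) τ (extChartAt 𝓘(𝕜, F) w₀ w₀))
    (hT : HasFDerivAt τ (T : F →L[𝕜] DarbouxSpace 𝕜 n) (extChartAt 𝓘(𝕜, F) w₀ w₀)) :
    ∀ᶠ w in 𝓝 w₀, (D w).map (mfderiv 𝓘(𝕜, F) 𝓘(𝕜, DarbouxSpace 𝕜 n)
      (τ ∘ extChartAt 𝓘(𝕜, F) w₀) w).toLinearMap =
        stdContact 𝕜 n ((τ ∘ extChartAt 𝓘(𝕜, F) w₀) w) := by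
  have hc : ContinuousAt (extChartAt 𝓘(𝕜, F) w₀) w₀ := continuousAt_extChartAt w₀
  have hinv : ∀ᶠ y in 𝓝 (extChartAt 𝓘(𝕜, F) w₀ w₀), (fderiv 𝕜 τ y).IsInvertible :=
    eventually_isInvertible (hτ.self_of_nhds.1.fderiv_right (m := 0) (by simp)).continuousAt
      ⟨T, hT.fderiv.symm⟩
  filter_upwards [hα, hc.eventually hτ, hc.eventually hinv,
    (chartAt F w₀).open_source.mem_nhds (mem_chart_source F w₀)] with w h1 h2 h3 h4
  set M := mfderiv 𝓘(𝕜, F) 𝓘(𝕜, F) (extChartAt 𝓘(𝕜, F) w₀) w with hM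
  have hd : ∀ v : TangentSpace 𝓘(𝕜, F) w, mfderiv 𝓘(𝕜, F) 𝓘(𝕜, DarbouxSpace 𝕜 n)
      (τ ∘ extChartAt 𝓘(𝕜, F) w₀) w v = fderiv 𝕜 τ (extChartAt 𝓘(𝕜, F) w₀ w) (M v) := by
    intro v
    have h5 : ContMDiffAt 𝓘(𝕜, F) 𝓘(𝕜, F) ∞ (extChartAt 𝓘(𝕜, F) w₀) w :=
      contMDiffAt_extChartAt' h4
    have h6 : ContMDiffAt 𝓘(𝕜, F) 𝓘(𝕜, DarbouxSpace 𝕜 n) ∞ τ (extChartAt 𝓘(𝕜, F) w₀ w) :=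
      contMDiffAt_iff_contDiffAt.2 h2.1
    rw [mfderiv_comp_apply w (h6.mdifferentiableAt (by simp)) (h5.mdifferentiableAt (by simp)) v,
      mfderiv_eq_fderiv]
    rfl
  have hMs : Function.Surjective M := by
    obtain ⟨M', hM'⟩ := isInvertible_mfderiv_extChartAt (I := 𝓘(𝕜, F)) (x := w₀) (y := w)
      (by rwa [extChartAt_source])
    rw [hM, ← hM']
    exact M'.surjective
  have hLs : Function.Surjective (fderiv 𝕜 τ (extChartAt 𝓘(𝕜, F) w₀ w)) := by
    obtain ⟨L, hL⟩ := h3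
    rw [← hL]
    exact L.surjective
  ext z
  rw [Submodule.mem_map]
  constructor
  · rintro ⟨v, hv, rfl⟩
    refine LinearMap.mem_ker.2 ?_
    have h5 := h2.2 _ ((h1 v).1 hv)
    exact (congrArg _ (hd v)).trans h5
  · intro hz
    obtain ⟨y, hy⟩ := hLs z
    obtain ⟨v, hv⟩ := hMs y
    refine ⟨v, (h1 v).2 ?_, ?_⟩
    · refine apply_eq_zero_of_ker_le hLs (stdForm_ne_zero n _) h2.2 ?_
      have h5 : fderiv 𝕜 τ (extChartAt 𝓘(𝕜, F) w₀ w) (M v) = z := by rw [hv]; exact hy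
      exact (congrArg _ h5).trans (LinearMap.mem_ker.1 hz)
    · refine (hd v).trans ?_
      rw [hv]
      exact hy

end Charts

end ContactGerm

end

/-! ### The normal form on manifolds -/

theorem proposition2p1 {𝕜 : Type*} [RCLike 𝕜] (m : ℕ)
    {E : Type*} [NormedAddCommGroup E] [NormedSpace 𝕜 E] [FiniteDimensional 𝕜 E]
    (hE : Module.finrank 𝕜 E = m + 1)
    {F : Type*} [NormedAddCommGroup F] [NormedSpace 𝕜 F] [FiniteDimensional 𝕜 F]
    (hF : Module.finrank 𝕜 F = 2 * (m + 1) + 1)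
    {N : Type*} [TopologicalSpace N] [ChartedSpace E N] [IsManifold 𝓘(𝕜, E) ∞ N]
    {W : Type*} [TopologicalSpace W] [ChartedSpace F W] [IsManifold 𝓘(𝕜, F) ∞ W]
    (D : ∀ w : W, Submodule 𝕜 (TangentSpace 𝓘(𝕜, F) w))
    (hD : ContactGerm.IsContactStructure D)
    (f : N → W) (x₀ : N)
    (hf : ContactGerm.IsIntegralGerm (E := E) D f x₀)
    (hcorank : ContactGerm.corank 𝕜 (E := E) (F := F) f x₀ ≤ 1) :
    ∃ u v : (Fin (m + 1) → 𝕜) → 𝕜,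
      (∀ᶠ x in 𝓝 0, ContDiffAt 𝕜 ∞ u x) ∧ u 0 = 0 ∧
      (∀ᶠ x in 𝓝 0, ContDiffAt 𝕜 ∞ v x) ∧ v 0 = 0 ∧
      ContactGerm.preNormal u v 0 = 0 ∧
      ContactGerm.IsIntegralGerm (E := Fin (m + 1) → 𝕜) (ContactGerm.stdContact 𝕜 (m + 1))
        (ContactGerm.preNormal u v) 0 ∧
      ContactGerm.Contactomorphic (E := E) (E' := Fin (m + 1) → 𝕜) D f x₀
        (ContactGerm.stdContact 𝕜 (m + 1)) (ContactGerm.preNormal u v) 0 := by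
  have : CompleteSpace E := FiniteDimensional.complete 𝕜 E
  have : CompleteSpace F := FiniteDimensional.complete 𝕜 F
  obtain ⟨α, hα, hαD⟩ := hD (f x₀)
  set h : E → F := writtenInExtChartAt 𝓘(𝕜, E) 𝓘(𝕜, F) x₀ f with hh
  have hh0 : h (extChartAt 𝓘(𝕜, E) x₀ x₀) = extChartAt 𝓘(𝕜, F) (f x₀) (f x₀) := by
    simp [hh, writtenInExtChartAt]
  have hhi : ContactGerm.IsIntegralMapGerm α h (extChartAt 𝓘(𝕜, E) x₀ x₀) :=
    hf.isIntegralMapGerm hαD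
  have hker : Module.finrank 𝕜
      (LinearMap.ker (fderiv 𝕜 h (extChartAt 𝓘(𝕜, E) x₀ x₀)).toLinearMap) ≤ 1 := by
    rw [ContactGerm.fderiv_writtenInExtChartAt hf.self_of_nhds.1]
    exact hcorank
  rw [← hh0] at hα
  obtain ⟨u, v, hu, hu0, hv, hv0, huv0, huv, σ, S, τ, T, hσs, hσ0, hσd, hτ0, hτd, hτ, heq⟩ :=
    ContactGerm.exists_preNormal hE hF (hα.mono fun _ hz => hz.1) hα.self_of_nhds.2 hhi hker
  rw [hh0] at hτ0 hτd hτ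
  refine ⟨u, v, hu, hu0, hv, hv0, huv0, huv.isIntegralGerm, σ ∘ extChartAt 𝓘(𝕜, E) x₀,
    τ ∘ extChartAt 𝓘(𝕜, F) (f x₀), ContactGerm.isLocalDiffeomorphAt_comp_extChartAt hσs hσd, hσ0,
    ContactGerm.isLocalDiffeomorphAt_comp_extChartAt (hτ.mono fun _ hz => hz.1) hτd,
    hτ0.trans huv0.symm, ContactGerm.eventually_map_eq_stdContact hαD hτ hτd, ?_⟩
  have hfc : ContinuousAt f x₀ := hf.self_of_nhds.1.continuousAt
  filter_upwards [(continuousAt_extChartAt (I := 𝓘(𝕜, E)) x₀).eventually heq,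
    extChartAt_source_mem_nhds (I := 𝓘(𝕜, E)) x₀] with x hx hx'
  refine hx.trans ?_
  simp only [Function.comp_apply, hh, writtenInExtChartAt]
  rw [(extChartAt 𝓘(𝕜, E) x₀).left_inv hx']
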